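/- Let $d\ge 1$ and let $\Omega\subset\mathbb R^d$ be a Lipschitz domain of finite measure (an open set which near each of its boundary points is the region above the graph of a Lipschitz function in suitable Cartesian coordinates). An Orlicz function is a convex, left-continuous function $f:[0,\infty)\to[0,\infty]$ with $f(0)=0$, $\lim_{t\to0}f(t)=0$ and $\lim_{t\to\infty}f(t)=\infty$. Let $\phi,\psi$ be Orlicz functions, let $a$ be a nonnegative, bounded, measurable function on $\Omega$, and put $$\Phi(x,t):=\phi(t)+a(x)\psi(t)\qquad(x\in\Omega,\ t\ge 0)$$ (with $0\cdot\infty=0$). Assume that $\Phi$ satisfies the $\Delta_2$-condition: there is $c\ge 2$ with $\Phi(x,2t)\le c\,\Phi(x,t)$ for all $x\in\Omega$, $t\ge0$. Assume that $a$ has a modulus of continuity $\omega$, that is, $|a(x)-a(y)|\le\omega(|x-y|)$ for all $x,y\in\Omega$ with $|x-y|\le\frac14$, such that for some constant $k_0\ge0$ and all $0<\epsilon\le\frac14$ $$\omega(\epsilon)\le k_0\frac{\phi(t)}{\psi(t)}\quad\text{for } 1\le t\le\epsilon^{-d}$$ (understood as $\omega(\epsilon)\psi(t)\le k_0\phi(t)$).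 Let $\|f\|_{L^{\Phi(\cdot)}(\Omega)}:=\inf\{\gamma>0:\int_\Omega\Phi(x,|f(x)|/\gamma)\,dx\le1\}$, let $L^{\Phi(\cdot)}(\Omega)$ be the set of measurable $f$ for which this is finite, let $W^{1,1}_0(\Omega)$ be the closure of $C_0^\infty(\Omega)$ in $W^{1,1}(\Omega)$, and let $W^{1,\Phi(\cdot)}_0(\Omega):=\{w\in W^{1,1}_0(\Omega):\nabla w\in L^{\Phi(\cdot)}(\Omega)\}$ with the norm $\|\nabla w\|_{L^{\Phi(\cdot)}(\Omega)}$. Then: 1. $\Phi$ is regular in $\Omega$: for every $u\in W^{1,\Phi(\cdot)}_0(\Omega)$ with $\int_\Omega\Phi(x,|\nabla u|)\,dx<\infty$ there is a sequence $u_n\in C_0^\infty(\Omega)$ such that $u_n\to u$ in $W^{1,1}(\Omega)$ and $\int_\Omega\Phi(x,|\nabla u_n|)\,dx\to\int_\Omega\Phi(x,|\nabla u|)\,dx$. 2. In particular, $C_0^\infty(\Omega)$ is a dense subset of $W^{1,\Phi(\cdot)}_0(\Omega)$. -/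

import Mathlib

open MeasureTheory Filter Topology
open scoped NNReal ENNReal

noncomputable section

namespace DoublePhase

/-- The Euclidean space `ℝ^d`. -/
abbrev Eucl (d : ℕ) : Type := EuclideanSpace ℝ (Fin d)

/-- Orlicz functions `[0,∞) → [0,∞]`. -/
structure IsOrlicz (f : ℝ≥0 → ℝ≥0∞) : Prop where
  convex : ConvexOn ℝ≥0 Set.univ f
  left_continuous : ∀ t, ContinuousWithinAt f (Set.Iio t) t
  map_zero : f 0 = 0
  tendsto_zero : Tendsto f (𝓝[>] 0) (𝓝 0)
  tendsto_atTop : Tendsto f atTop (𝓝 ∞)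

variable {d : ℕ}

/-- `Ω` has (locally) Lipschitz boundary: near each boundary point there are a unit vector `e` and
a Lipschitz function `g` on the hyperplane orthogonal to `e` such that `Ω` is the region
above the graph of `g` in direction `e`. (A Lipschitz function on the hyperplane is the same as the
restriction of a Lipschitz function on `ℝ^d`; `x - ⟪e, x⟫ e` is the orthogonal projection of `x` to
the hyperplane.) -/
def HasLipschitzBoundary (Ω : Set (Eucl d)) : Prop :=
  ∀ x₀ ∈ frontier Ω, ∃ e : Eucl d, ‖e‖ = 1 ∧ ∃ (K : ℝ≥0) (g : Eucl d → ℝ), LipschitzWith K g ∧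
    ∃ r > 0, ∀ x ∈ Metric.ball x₀ r, (x ∈ Ω ↔ g (x - inner ℝ e x • e) < inner ℝ e x)

/-- The double phase integrand `Φ(x,t) = φ(t) + a(x) ψ(t)` (for `a ≥ 0`). -/
def doublePhase (φ ψ : ℝ≥0 → ℝ≥0∞) (a : Eucl d → ℝ) (x : Eucl d) (t : ℝ≥0) : ℝ≥0∞ :=
  φ t + ENNReal.ofReal (a x) * ψ t

/-- The `Δ₂`-condition, uniform in `x ∈ Ω`. -/
def DeltaTwo (Ω : Set (Eucl d)) (Φ : Eucl d → ℝ≥0 → ℝ≥0∞) : Prop :=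
  ∃ c : ℝ≥0, 2 ≤ c ∧ ∀ x ∈ Ω, ∀ t, Φ x (2 * t) ≤ c * Φ x t

/-- `ω` is a modulus of continuity of `a` on `Ω` (for distances at most `1/4`). -/
def IsModulusOfContinuityOn (Ω : Set (Eucl d)) (a : Eucl d → ℝ) (ω : ℝ → ℝ) : Prop :=
  ∀ x ∈ Ω, ∀ y ∈ Ω, dist x y ≤ 1 / 4 → |a x - a y| ≤ ω (dist x y)

/-- `v ∈ C₀^∞(Ω)`. -/
def IsTestFunction (Ω : Set (Eucl d)) (v : Eucl d → ℝ) : Prop :=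
  ContDiff ℝ ((⊤ : ℕ∞) : WithTop ℕ∞) v ∧ HasCompactSupport v ∧ tsupport v ⊆ Ω

/-- `G` is the weak gradient of `u` in `Ω`. -/
def IsWeakGradient (Ω : Set (Eucl d)) (u : Eucl d → ℝ) (G : Eucl d → Eucl d) : Prop :=
  LocallyIntegrableOn u Ω ∧ LocallyIntegrableOn G Ω ∧
    ∀ ζ, IsTestFunction Ω ζ → ∫ x in Ω, u x • gradient ζ x = -∫ x in Ω, ζ x • G x

/-- `u ∈ W^{1,1}(Ω)` with weak gradient `G`. -/
def MemW11 (Ω : Set (Eucl d)) (u : Eucl d → ℝ) (G : Eucl d → Eucl d) : Prop :=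
  IsWeakGradient Ω u G ∧ IntegrableOn u Ω ∧ IntegrableOn G Ω

/-- The smooth functions `v n` converge in `W^{1,1}(Ω)` to `u`, whose weak gradient is `G`. -/
def TendstoW11 (Ω : Set (Eucl d)) (v : ℕ → Eucl d → ℝ) (u : Eucl d → ℝ) (G : Eucl d → Eucl d) :
    Prop :=
  Tendsto (fun n => eLpNorm (fun x => v n x - u x) 1 (volume.restrict Ω)) atTop (𝓝 0) ∧
  Tendsto (fun n => eLpNorm (fun x => gradient (v n) x - G x) 1 (volume.restrict Ω)) atTop (𝓝 0)

/-- `u ∈ W₀^{1,1}(Ω)`, the closure of `C₀^∞(Ω)` in `W^{1,1}(Ω)`, with weak gradient `G`. -/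
def MemW11Zero (Ω : Set (Eucl d)) (u : Eucl d → ℝ) (G : Eucl d → Eucl d) : Prop :=
  MemW11 Ω u G ∧ ∃ v : ℕ → Eucl d → ℝ, (∀ n, IsTestFunction Ω (v n)) ∧ TendstoW11 Ω v u G

/-- The modular `∫_Ω Φ(x,|f(x)|) dx`. For `f = ∇w` it is the energy `𝓕(w)`. -/
def modular (Ω : Set (Eucl d)) (Φ : Eucl d → ℝ≥0 → ℝ≥0∞) (f : Eucl d → Eucl d) : ℝ≥0∞ :=
  ∫⁻ x in Ω, Φ x ‖f x‖₊

/-- The Luxemburg norm `inf {γ > 0 : ∫_Ω Φ(x,|f(x)|/γ) dx ≤ 1}` (infinite if there is no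
such `γ`). -/
def luxemburgNorm (Ω : Set (Eucl d)) (Φ : Eucl d → ℝ≥0 → ℝ≥0∞) (f : Eucl d → Eucl d) : ℝ≥0∞ :=
  ⨅ (γ : ℝ≥0) (_ : 0 < γ) (_ : ∫⁻ x in Ω, Φ x (‖f x‖₊ / γ) ≤ 1), (γ : ℝ≥0∞)

/-- `f ∈ L^Φ(Ω)` (vector valued). -/
def MemLPhi (Ω : Set (Eucl d)) (Φ : Eucl d → ℝ≥0 → ℝ≥0∞) (f : Eucl d → Eucl d) : Prop :=
  AEStronglyMeasurable f (volume.restrict Ω) ∧ luxemburgNorm Ω Φ f < ∞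

/-- `u ∈ W₀^{1,Φ}(Ω)` with weak gradient `G`. -/
def MemW1PhiZero (Ω : Set (Eucl d)) (Φ : Eucl d → ℝ≥0 → ℝ≥0∞) (u : Eucl d → ℝ)
    (G : Eucl d → Eucl d) : Prop :=
  MemW11Zero Ω u G ∧ MemLPhi Ω Φ G

/-- The integrand `Φ` is regular in `Ω`: every `u ∈ W₀^{1,Φ}(Ω)` of finite energy is the
`W^{1,1}`-limit of `C₀^∞(Ω)` functions whose energies converge to that of `u`. -/
def IsRegular (Ω : Set (Eucl d)) (Φ : Eucl d → ℝ≥0 → ℝ≥0∞) : Prop :=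
  ∀ u G, MemW1PhiZero Ω Φ u G → modular Ω Φ G < ∞ →
    ∃ v : ℕ → Eucl d → ℝ, (∀ n, IsTestFunction Ω (v n)) ∧ TendstoW11 Ω v u G ∧
      Tendsto (fun n => modular Ω Φ (gradient (v n))) atTop (𝓝 (modular Ω Φ G))

/-- `C₀^∞(Ω)` is a dense subset of `W₀^{1,Φ}(Ω)`, whose norm is `‖∇w‖_{L^Φ(Ω)}`. -/
def TestFunctionsDense (Ω : Set (Eucl d)) (Φ : Eucl d → ℝ≥0 → ℝ≥0∞) : Prop :=
  (∀ v, IsTestFunction Ω v → MemW1PhiZero Ω Φ v (gradient v)) ∧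
  ∀ u G, MemW1PhiZero Ω Φ u G → ∀ η : ℝ≥0∞, 0 < η →
    ∃ v, IsTestFunction Ω v ∧ luxemburgNorm Ω Φ (fun x => G x - gradient v x) < η

end DoublePhase

end

noncomputable section

namespace DoublePhase

variable {d : ℕ}

/-! ### Convex functions with values in `[0,∞]` -/

/-! Smooth functions are obtained by convolution. The difficulty is the dependence of `Φ` on `x`:
Jensen's inequality works for a fixed convex function, while the convolution at `x` averages values
of the gradient at nearby points `y`. If the kernel lives at scale `δ` and is bounded by a multiple
of `δ ^ (-d)`, then the convolution of `G ∈ L¹` is bounded by a multiple of `δ ^ (-d)`. Up to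
exactly this size the condition on `ω` makes the oscillation of `a` times `ψ` harmless against `φ`,
so at the relevant argument `Φ x` is controlled by one convex function lying below all `Φ y` with
`y` near `x`. Jensen applied to that function gives `Φ(x, |k * G|) ≤ C (1 + k * Φ(·, |G|))`
(`IsAdmissible.exists_kernelConv_le`). Since `k * Φ(·, |G|)` converges in `L¹`, dominated
convergence shows that the modular of `k * G - G` tends to zero (`Approximable.of_translate_mem`).

The convolution must also have compact support in `Ω`. Near a boundary point a Lipschitz graph
admits a cone of directions leading into `Ω`, so a kernel centred at `δ • e` instead of the origin
pushes the support inside (`HasLipschitzBoundary.exists_translate_mem`).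

A general `u` is reduced to this local case by truncation (`Approximable.of_memW11Zero`), by a
cutoff at infinity because `Ω` may be unbounded (`Approximable.of_bounded`), and by a partition of
unity (`Approximable.of_bounded_of_support`). Truncation has to precede the cutoffs: only for
bounded `u` is the extra term `u ∇χ` bounded, hence of finite modular on a set of finite measure.

Each reduction preserves `Approximable`, a statement about the modular of the difference of
gradients. Dominated convergence turns it into convergence of energies, and `Δ₂` turns it into
convergence in the Luxemburg norm. -/

theorem convexOn_smul_le {f : ℝ≥0 → ℝ≥0∞} (hf : ConvexOn ℝ≥0 Set.univ f) (h0 : f 0 = 0)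
    {s : ℝ≥0} (hs : s ≤ 1) (t : ℝ≥0) : f (s * t) ≤ s * f t := by
  have h := hf.2 (Set.mem_univ t) (Set.mem_univ 0) zero_le zero_le
    (add_tsub_cancel_of_le hs)
  simpa [h0, ENNReal.smul_def] using h

theorem monotone_of_convexOn {f : ℝ≥0 → ℝ≥0∞} (hf : ConvexOn ℝ≥0 Set.univ f) (h0 : f 0 = 0) :
    Monotone f := by
  intro s t hst
  rcases eq_or_ne t 0 with rfl | ht
  · rw [le_antisymm hst zero_le]
  have h1 : s / t ≤ 1 := div_le_one_of_le₀ hst zero_le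
  have h := convexOn_smul_le hf h0 h1 t
  rw [div_mul_cancel₀ _ ht] at h
  refine h.trans ?_
  calc ((s / t : ℝ≥0) : ℝ≥0∞) * f t ≤ 1 * f t := by gcongr; exact_mod_cast h1
    _ = f t := one_mul _

theorem convexOn_toReal_nnnorm {F : Type*} [NormedAddCommGroup F] [NormedSpace ℝ F]
    {Λ : ℝ≥0 → ℝ≥0∞} (hΛ : ConvexOn ℝ≥0 Set.univ Λ) (h0 : Λ 0 = 0) (hfin : ∀ t, Λ t ≠ ∞) :
    ConvexOn ℝ Set.univ (fun v : F => (Λ ‖v‖₊).toReal) := by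
  have hmono := monotone_of_convexOn hΛ h0
  refine ⟨convex_univ, fun v _ w _ a b ha hb hab => ?_⟩
  lift a to ℝ≥0 using ha
  lift b to ℝ≥0 using hb
  have h1 : Λ ‖(a : ℝ) • v + (b : ℝ) • w‖₊ ≤ a * Λ ‖v‖₊ + b * Λ ‖w‖₊ := by
    have h2 := hΛ.2 (Set.mem_univ ‖v‖₊) (Set.mem_univ ‖w‖₊) zero_le zero_le
      (by exact_mod_cast hab)
    refine (hmono ?_).trans (by simpa [ENNReal.smul_def] using h2)
    refine (nnnorm_add_le _ _).trans ?_
    simp [nnnorm_smul]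
  have h3 := ENNReal.toReal_mono (ENNReal.add_ne_top.2
    ⟨ENNReal.mul_ne_top ENNReal.coe_ne_top (hfin _),
      ENNReal.mul_ne_top ENNReal.coe_ne_top (hfin _)⟩) h1
  rwa [ENNReal.toReal_add (ENNReal.mul_ne_top ENNReal.coe_ne_top (hfin _))
    (ENNReal.mul_ne_top ENNReal.coe_ne_top (hfin _)), ENNReal.toReal_mul,
    ENNReal.toReal_mul] at h3

/-- Composing with the norm on `ℝ` makes `0` an interior point, so that a finite convex function is
continuous there as well. -/
theorem continuous_of_convexOn {Λ : ℝ≥0 → ℝ≥0∞} (hΛ : ConvexOn ℝ≥0 Set.univ Λ) (h0 : Λ 0 = 0)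
    (hfin : ∀ t, Λ t ≠ ∞) : Continuous Λ := by
  have hc : Continuous (fun v : ℝ => (Λ ‖v‖₊).toReal) :=
    continuousOn_univ.1 ((convexOn_toReal_nnnorm hΛ h0 hfin).continuousOn isOpen_univ)
  have h := ENNReal.continuous_ofReal.comp (hc.comp NNReal.continuous_coe)
  refine h.congr fun t => ?_
  simp [ENNReal.ofReal_toReal (hfin _)]

/-- Jensen's inequality for a convex function of the norm. -/
theorem convexOn_nnnorm_integral_le {α F : Type*} [MeasurableSpace α] {μ : Measure α}
    [NormedAddCommGroup F] [NormedSpace ℝ F] [FiniteDimensional ℝ F]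
    {Λ : ℝ≥0 → ℝ≥0∞} (hΛ : ConvexOn ℝ≥0 Set.univ Λ) (h0 : Λ 0 = 0) (hfin : ∀ t, Λ t ≠ ∞)
    {k : α → ℝ} (hk0 : ∀ x, 0 ≤ k x) (hki : Integrable k μ) (hk1 : ∫ x, k x ∂μ = 1)
    {H : α → F} (hH : AEStronglyMeasurable H μ) (hkH : Integrable (fun x => k x • H x) μ) :
    Λ ‖∫ x, k x • H x ∂μ‖₊ ≤ ∫⁻ x, ENNReal.ofReal (k x) * Λ ‖H x‖₊ ∂μ := by
  have : CompleteSpace F := FiniteDimensional.complete ℝ F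
  have hmono := monotone_of_convexOn hΛ h0
  -- The weight `k` becomes a probability measure, for which Jensen's inequality is available;
  -- passing to real values is harmless because the case of an infinite right side is trivial.
  set ν := μ.withDensity (fun x => ENNReal.ofReal (k x)) with hν
  have hkm : AEMeasurable (fun x => ENNReal.ofReal (k x)) μ := hki.1.aemeasurable.ennreal_ofReal
  have hprob : IsProbabilityMeasure ν := by
    constructor
    rw [hν, withDensity_apply _ MeasurableSet.univ, Measure.restrict_univ,
      ← ofReal_integral_eq_lintegral_ofReal hki (Eventually.of_forall hk0), hk1,
      ENNReal.ofReal_one]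
  have hfink : ∀ᵐ x ∂μ, ENNReal.ofReal (k x) < ∞ := Eventually.of_forall fun x => by simp
  have hint : ∀ g : α → F, ∫ x, g x ∂ν = ∫ x, k x • g x ∂μ := by
    intro g
    rw [hν, integral_withDensity_eq_integral_toReal_smul₀ hkm hfink]
    simp [ENNReal.toReal_ofReal (hk0 _)]
  have hHν : AEStronglyMeasurable H ν := hH.mono_ac (withDensity_absolutelyContinuous _ _)
  have hHi : Integrable H ν := by
    rw [hν, integrable_withDensity_iff_integrable_smul₀' hkm hfink]
    simpa [ENNReal.toReal_ofReal (hk0 _)] using hkH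
  have hconv := convexOn_toReal_nnnorm (F := F) hΛ h0 hfin
  have hcont : ContinuousOn (fun v : F => (Λ ‖v‖₊).toReal) Set.univ :=
    hconv.continuousOn isOpen_univ
  have hmeas : AEMeasurable (fun x => Λ ‖H x‖₊) μ :=
    hmono.measurable.comp_aemeasurable hH.nnnorm.aemeasurable
  have hlin : ∫⁻ x, ENNReal.ofReal (k x) * Λ ‖H x‖₊ ∂μ = ∫⁻ x, Λ ‖H x‖₊ ∂ν := by
    rw [hν, lintegral_withDensity_eq_lintegral_mul₀ hkm hmeas]
    rfl
  rw [hlin]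
  by_cases htop : ∫⁻ x, Λ ‖H x‖₊ ∂ν = ∞
  · simp [htop]
  have hmeasν : AEMeasurable (fun x => Λ ‖H x‖₊) ν :=
    hmono.measurable.comp_aemeasurable hHν.nnnorm.aemeasurable
  have hΛi : Integrable (fun x => (Λ ‖H x‖₊).toReal) ν :=
    integrable_toReal_of_lintegral_ne_top hmeasν htop
  have hJ := hconv.map_integral_le hcont isClosed_univ (Eventually.of_forall fun _ => Set.mem_univ _)
    hHi hΛi
  rw [integral_toReal hmeasν (Eventually.of_forall fun x => (hfin _).lt_top), hint] at hJ
  exact (ENNReal.toReal_le_toReal (hfin _) htop).1 hJ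

/-! ### Admissible integrands -/

/-- Convex integrands with the `Δ₂`-condition, bounded in `x`, which at the points of a ball of
radius `ε` are comparable with a common convex function, up to the size `ε ^ (-d)` of the
argument. -/
structure IsAdmissible (Ω : Set (Eucl d)) (Φ : Eucl d → ℝ≥0 → ℝ≥0∞) : Prop where
  convex : ∀ x ∈ Ω, ConvexOn ℝ≥0 Set.univ (Φ x)
  map_zero : ∀ x ∈ Ω, Φ x 0 = 0
  tendsto_zero : ∀ x ∈ Ω, Tendsto (Φ x) (𝓝 0) (𝓝 0)
  deltaTwo : DeltaTwo Ω Φ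
  aemeasurable : ∀ f : Eucl d → ℝ≥0, AEMeasurable f (volume.restrict Ω) →
    AEMeasurable (fun x => Φ x (f x)) (volume.restrict Ω)
  bounded : ∀ T : ℝ≥0, ∃ C : ℝ≥0, ∀ x ∈ Ω, Φ x T ≤ C
  comparison : ∃ C : ℝ≥0, ∀ x ∈ Ω, ∀ ε : ℝ, 0 < ε → ε ≤ 1 / 4 → ∀ t : ℝ≥0, 1 ≤ t →
    (t : ℝ) ≤ ε ^ (-(d : ℤ)) → ∃ Λ : ℝ≥0 → ℝ≥0∞, ConvexOn ℝ≥0 Set.univ Λ ∧ Λ 0 = 0 ∧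
      (∀ τ, Λ τ ≠ ∞) ∧ Φ x t ≤ C * Λ t ∧ ∀ y ∈ Ω, dist x y ≤ ε → ∀ τ, Λ τ ≤ Φ y τ

theorem IsOrlicz.tendsto_nhds_zero {f : ℝ≥0 → ℝ≥0∞} (hf : IsOrlicz f) :
    Tendsto f (𝓝 0) (𝓝 0) := by
  have h : insert (0 : ℝ≥0) (Set.Ioi 0) = Set.univ := by
    ext x
    simp
  rw [← nhdsWithin_univ, ← h, nhdsWithin_insert]
  refine Tendsto.sup ?_ hf.tendsto_zero
  rw [← hf.map_zero]
  exact tendsto_pure_nhds f 0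

theorem IsOrlicz.monotone {f : ℝ≥0 → ℝ≥0∞} (hf : IsOrlicz f) : Monotone f :=
  monotone_of_convexOn hf.convex hf.map_zero

theorem convexOn_add_mul {φ ψ : ℝ≥0 → ℝ≥0∞} (hφ : ConvexOn ℝ≥0 Set.univ φ)
    (hψ : ConvexOn ℝ≥0 Set.univ ψ) (α : ℝ≥0∞) :
    ConvexOn ℝ≥0 Set.univ (fun t => φ t + α * ψ t) := by
  refine ⟨convex_univ, fun s hs t ht a b ha hb hab => ?_⟩
  have h1 := hφ.2 hs ht ha hb hab
  have h2 := hψ.2 hs ht ha hb hab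
  simp only [ENNReal.smul_def, smul_eq_mul] at h1 h2 ⊢
  calc φ (a * s + b * t) + α * ψ (a * s + b * t)
      ≤ (a * φ s + b * φ t) + α * (a * ψ s + b * ψ t) := by gcongr
    _ = a * (φ s + α * ψ s) + b * (φ t + α * ψ t) := by ring

/-- Halving `t` often enough reaches a point where `f < 1`; doubling back costs only a finite factor
`c ^ n`. -/
theorem ne_top_of_doubling {f : ℝ≥0 → ℝ≥0∞} (hf0 : Tendsto f (𝓝 0) (𝓝 0)) (c : ℝ≥0)
    (hc : ∀ t, f (2 * t) ≤ c * f t) (t : ℝ≥0) : f t ≠ ∞ := by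
  have h1 : ∀ n : ℕ, ∀ s, f (2 ^ n * s) ≤ c ^ n * f s := by
    intro n
    induction n with
    | zero => simp
    | succ n ih =>
      intro s
      calc f (2 ^ (n + 1) * s) = f (2 * (2 ^ n * s)) := by ring_nf
        _ ≤ c * f (2 ^ n * s) := hc _
        _ ≤ c * (c ^ n * f s) := by gcongr; exact ih s
        _ = c ^ (n + 1) * f s := by ring
  have h2 : Tendsto (fun n : ℕ => (1 / 2 : ℝ≥0) ^ n * t) atTop (𝓝 0) := by
    have h := (NNReal.tendsto_pow_atTop_nhds_zero_of_lt_one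
      (show (1 / 2 : ℝ≥0) < 1 from NNReal.half_lt_self one_ne_zero)).mul_const t
    simpa [doublePhase] using h
  obtain ⟨n, hn⟩ := ((hf0.comp h2).eventually_lt_const (show (0 : ℝ≥0∞) < 1 by simp)).exists
  have h3 := h1 n ((1 / 2 : ℝ≥0) ^ n * t)
  rw [← mul_assoc, ← mul_pow, mul_one_div_cancel two_ne_zero, one_pow, one_mul] at h3
  refine (h3.trans_lt ?_).ne
  exact ENNReal.mul_lt_top (ENNReal.pow_lt_top ENNReal.coe_lt_top)
    (hn.trans ENNReal.one_lt_top)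

theorem isAdmissible_doublePhase {Ω : Set (Eucl d)}
    {φ ψ : ℝ≥0 → ℝ≥0∞} (hφ : IsOrlicz φ) (hψ : IsOrlicz ψ)
    {a : Eucl d → ℝ} (ha_meas : AEMeasurable a (volume.restrict Ω))
    (ha_nonneg : ∀ x ∈ Ω, 0 ≤ a x) (ha_bdd : ∃ A : ℝ, ∀ x ∈ Ω, a x ≤ A)
    (hΔ : DeltaTwo Ω (doublePhase φ ψ a))
    {ω : ℝ → ℝ} (hω : IsModulusOfContinuityOn Ω a ω) {k₀ : ℝ≥0}
    (hωφψ : ∀ ε : ℝ, 0 < ε → ε ≤ 1 / 4 → ∀ t : ℝ≥0, 1 ≤ t → (t : ℝ) ≤ ε ^ (-(d : ℤ)) →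
      ENNReal.ofReal (ω ε) * ψ t ≤ k₀ * φ t) :
    IsAdmissible Ω (doublePhase φ ψ a) := by
  have htend : ∀ x, Tendsto (doublePhase φ ψ a x) (𝓝 0) (𝓝 0) := by
    intro x
    have h := hφ.tendsto_nhds_zero.add
      (ENNReal.Tendsto.const_mul hψ.tendsto_nhds_zero (Or.inr ENNReal.ofReal_ne_top)
        (a := ENNReal.ofReal (a x)))
    simp only [mul_zero, add_zero] at h
    exact h
  have hfin : ∀ x ∈ Ω, ∀ t, doublePhase φ ψ a x t ≠ ∞ := by
    obtain ⟨c, -, hc⟩ := hΔ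
    exact fun x hx => ne_top_of_doubling (htend x) c (hc x hx)
  have hφfin : ∀ x ∈ Ω, ∀ t, φ t ≠ ∞ := fun x hx t => (ENNReal.add_ne_top.1 (hfin x hx t)).1
  have hψfin : ∀ x ∈ Ω, a x ≠ 0 → ∀ t, ψ t ≠ ∞ := by
    intro x hx hax t hψt
    have h := (ENNReal.add_ne_top.1 (hfin x hx t)).2
    rw [hψt, ENNReal.mul_top] at h
    · exact h rfl
    · simpa using lt_of_le_of_ne (ha_nonneg x hx) (Ne.symm hax)
  refine ⟨fun x _ => convexOn_add_mul hφ.convex hψ.convex _, fun x _ => ?_, fun x _ => htend x, hΔ,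
    fun f hf => ?_, fun T => ?_, ?_⟩
  · simp [doublePhase, hφ.map_zero, hψ.map_zero]
  · exact (hφ.monotone.measurable.comp_aemeasurable hf).add
      (ha_meas.ennreal_ofReal.mul (hψ.monotone.measurable.comp_aemeasurable hf))
  · obtain ⟨A, hA⟩ := ha_bdd
    rcases Set.eq_empty_or_nonempty Ω with rfl | ⟨x₀, hx₀⟩
    · exact ⟨0, by simp⟩
    -- If `a` vanishes on all of `Ω`, then `ψ` may take the value `∞` and must not enter the bound.
    by_cases h : ∃ x ∈ Ω, a x ≠ 0
    · obtain ⟨x, hx, hax⟩ := h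
      refine ⟨(φ T).toNNReal + A.toNNReal * (ψ T).toNNReal, fun y hy => ?_⟩
      push_cast
      rw [ENNReal.coe_toNNReal (hφfin x hx T), ENNReal.coe_toNNReal (hψfin x hx hax T)]
      unfold doublePhase
      gcongr
      exact ENNReal.ofReal_le_ofReal (hA y hy)
    · push Not at h
      refine ⟨(φ T).toNNReal, fun y hy => ?_⟩
      rw [ENNReal.coe_toNNReal (hφfin x₀ hx₀ T)]
      simp [doublePhase, h y hy]
  · refine ⟨1 + k₀, fun x hx ε hε hε4 t ht1 ht => ?_⟩
    -- Here `φ` itself serves as `Λ`, and finiteness of `ψ` is not at hand.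
    by_cases hax : a x = 0
    · refine ⟨φ, hφ.convex, hφ.map_zero, hφfin x hx, ?_, fun y _ _ τ => le_self_add⟩
      have : doublePhase φ ψ a x t = 1 * φ t := by simp [doublePhase, hax]
      rw [this]
      gcongr
      simp
    have hψf := hψfin x hx hax
    -- The weight of `ψ` in `Λ`: the truncated subtraction makes it the least `α` that the
    -- oscillation bound at this particular `t` allows. It lies below every `a y` with `dist x y ≤
    -- ε`, and `α ψ(t)` misses `a(x) ψ(t)` by at most `k₀ φ(t)`.
    set α : ℝ≥0∞ := (ENNReal.ofReal (a x) * ψ t - k₀ * φ t) / ψ t with hα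
    have hax_le : ∀ y ∈ Ω, dist x y ≤ ε →
        ENNReal.ofReal (a x) * ψ t ≤ ENNReal.ofReal (a y) * ψ t + k₀ * φ t := by
      intro y hy hxy
      rcases eq_or_ne x y with rfl | hne
      · exact le_self_add
      have hd : 0 < dist x y := dist_pos.2 hne
      have h1 := hω x hx y hy (hxy.trans hε4)
      -- The growth condition is used at scale `dist x y ≤ ε`, where the admissible range of `t` is
      -- even larger; so `ω` need not be monotone.
      have h2 := hωφψ (dist x y) hd (hxy.trans hε4) t ht1 (ht.trans (by
        rw [zpow_neg, zpow_neg, zpow_natCast, zpow_natCast]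
        gcongr))
      calc ENNReal.ofReal (a x) * ψ t
          ≤ (ENNReal.ofReal (a y) + ENNReal.ofReal (ω (dist x y))) * ψ t := by
            gcongr
            refine (ENNReal.ofReal_le_ofReal ?_).trans ENNReal.ofReal_add_le
            linarith [le_abs_self (a x - a y)]
        _ ≤ ENNReal.ofReal (a y) * ψ t + k₀ * φ t := by
            rw [add_mul]
            gcongr
    have hα_le : ∀ y ∈ Ω, dist x y ≤ ε → α ≤ ENNReal.ofReal (a y) := fun y hy hxy =>
      ENNReal.div_le_of_le_mul (tsub_le_iff_right.2 (hax_le y hy hxy))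
    have hαtop : α ≠ ∞ := ((hα_le x hx (by simp [hε.le])).trans_lt ENNReal.ofReal_lt_top).ne
    refine ⟨fun τ => φ τ + α * ψ τ, convexOn_add_mul hφ.convex hψ.convex α,
      by simp [hφ.map_zero, hψ.map_zero],
      fun τ => ENNReal.add_ne_top.2 ⟨hφfin x hx τ, ENNReal.mul_ne_top hαtop (hψf τ)⟩, ?_,
      fun y hy hxy τ => ?_⟩
    · have h1 : ENNReal.ofReal (a x) * ψ t ≤ α * ψ t + k₀ * φ t := by
        rcases eq_or_ne (ψ t) 0 with h0 | h0
        · simp [h0]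
        rw [hα, ENNReal.div_mul_cancel h0 (hψf t)]
        exact le_tsub_add
      calc doublePhase φ ψ a x t ≤ φ t + (α * ψ t + k₀ * φ t) := by
            unfold doublePhase
            gcongr
        _ = (1 + k₀) * φ t + 1 * (α * ψ t) := by ring
        _ ≤ (1 + k₀) * φ t + (1 + k₀) * (α * ψ t) := by gcongr; simp
        _ = ((1 + k₀ : ℝ≥0) : ℝ≥0∞) * (φ t + α * ψ t) := by push_cast; ring
    · change φ τ + α * ψ τ ≤ φ τ + ENNReal.ofReal (a y) * ψ τ
      gcongr
      exact hα_le y hy hxy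

section Admissible

variable {Ω : Set (Eucl d)} {Φ : Eucl d → ℝ≥0 → ℝ≥0∞}

theorem IsAdmissible.monotone (hΦ : IsAdmissible Ω Φ) {x : Eucl d} (hx : x ∈ Ω) :
    Monotone (Φ x) :=
  monotone_of_convexOn (hΦ.convex x hx) (hΦ.map_zero x hx)

theorem IsAdmissible.exists_add_le (hΦ : IsAdmissible Ω Φ) :
    ∃ c : ℝ≥0, 1 ≤ c ∧ ∀ x ∈ Ω, ∀ s t, Φ x (s + t) ≤ c * (Φ x s + Φ x t) := by
  obtain ⟨c, hc2, hc⟩ := hΦ.deltaTwo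
  refine ⟨c, one_le_two.trans hc2, fun x hx s t => ?_⟩
  calc Φ x (s + t) ≤ Φ x (2 * max s t) := hΦ.monotone hx (by
        rw [two_mul]; exact add_le_add (le_max_left _ _) (le_max_right _ _))
    _ ≤ c * Φ x (max s t) := hc x hx _
    _ ≤ c * (Φ x s + Φ x t) := by
        gcongr
        rcases max_cases s t with h | h
        · rw [h.1]; exact le_self_add
        · rw [h.1]; exact le_add_self

theorem IsAdmissible.exists_mul_le (hΦ : IsAdmissible Ω Φ) (M : ℝ≥0) :
    ∃ c : ℝ≥0, 1 ≤ c ∧ ∀ x ∈ Ω, ∀ t, Φ x (M * t) ≤ c * Φ x t := by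
  obtain ⟨c, hc2, hc⟩ := hΦ.deltaTwo
  obtain ⟨n, hn⟩ := pow_unbounded_of_one_lt M (one_lt_two : (1 : ℝ≥0) < 2)
  refine ⟨c ^ n, one_le_pow₀ (one_le_two.trans hc2), fun x hx t => ?_⟩
  refine (hΦ.monotone hx (mul_le_mul_left hn.le t)).trans ?_
  clear hn
  induction n generalizing t with
  | zero => simp
  | succ n ih =>
    calc Φ x (2 ^ (n + 1) * t) = Φ x (2 ^ n * (2 * t)) := by ring_nf
      _ ≤ (c ^ n : ℝ≥0) * Φ x (2 * t) := ih _
      _ ≤ (c ^ n : ℝ≥0) * (c * Φ x t) := by gcongr; exact hc x hx t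
      _ = (c ^ (n + 1) : ℝ≥0) * Φ x t := by push_cast; ring

end Admissible

/-! ### Convolution with probability kernels -/

section Translation

variable {F : Type*} [NormedAddCommGroup F]

/-- Translation is continuous in `L¹`. -/
theorem tendsto_lintegral_enorm_translate_sub {f : Eucl d → F} (hf : Integrable f) :
    Tendsto (fun t => ∫⁻ x, ‖f (x - t) - f x‖ₑ) (𝓝 0) (𝓝 0) := by
  have hfL : MemLp f 1 volume := memLp_one_iff_integrable.2 hf
  let g : Eucl d → C(Eucl d, Eucl d) := fun t => ⟨fun x => x - t, by fun_prop⟩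
  have hg : Continuous g := ContinuousMap.continuous_of_continuous_uncurry _ (by
    change Continuous fun p : Eucl d × Eucl d => p.2 - p.1
    fun_prop)
  have hgm : ∀ t, MeasurePreserving (g t) volume volume := fun t => measurePreserving_sub_right _ t
  have h := (continuous_const (y := hfL.toLp f)).compMeasurePreservingLp hg hgm ENNReal.one_ne_top
  have h0 : Tendsto (fun t => edist (Lp.compMeasurePreserving (g t) (hgm t) (hfL.toLp f))
      (Lp.compMeasurePreserving (g 0) (hgm 0) (hfL.toLp f))) (𝓝 0) (𝓝 0) :=
    tendsto_iff_edist_tendsto_0.1 (h.tendsto 0)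
  refine h0.congr fun t => ?_
  rw [Lp.toLp_compMeasurePreserving, Lp.toLp_compMeasurePreserving, Lp.edist_toLp_toLp,
    eLpNorm_one_eq_lintegral_enorm]
  simp [g]

theorem aestronglyMeasurable_translate_sub {f : Eucl d → F} (hf : Integrable f) :
    AEStronglyMeasurable (fun p : Eucl d × Eucl d => f (p.1 - p.2) - f p.1)
      (volume.prod volume) :=
  (hf.1.comp_quasiMeasurePreserving (quasiMeasurePreserving_sub volume volume)).sub
    hf.1.comp_fst

end Translation

/-- The convolution of a function `f` with a kernel `k`. -/
def kernelConv {F : Type*} [NormedAddCommGroup F] [NormedSpace ℝ F] (k : Eucl d → ℝ)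
    (f : Eucl d → F) (x : Eucl d) : F :=
  ∫ t, k t • f (x - t)

/-- Smooth compactly supported probability densities. -/
structure IsKernel (k : Eucl d → ℝ) : Prop where
  contDiff : ContDiff ℝ ((⊤ : ℕ∞) : WithTop ℕ∞) k
  hasCompactSupport : HasCompactSupport k
  nonneg : ∀ x, 0 ≤ k x
  integral_eq_one : ∫ x, k x = 1

section Kernel

variable {F : Type*} [NormedAddCommGroup F] [NormedSpace ℝ F] {k : Eucl d → ℝ}

theorem IsKernel.integrable (hk : IsKernel k) : Integrable k :=
  hk.contDiff.continuous.integrable_of_hasCompactSupport hk.hasCompactSupport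

theorem IsKernel.lintegral_enorm (hk : IsKernel k) : ∫⁻ t, ‖k t‖ₑ = 1 := by
  have h : ∀ t, ‖k t‖ₑ = ENNReal.ofReal (k t) := fun t => Real.enorm_of_nonneg (hk.nonneg t)
  simp_rw [h]
  rw [← ofReal_integral_eq_lintegral_ofReal hk.integrable (Eventually.of_forall hk.nonneg),
    hk.integral_eq_one, ENNReal.ofReal_one]

theorem IsKernel.integrable_smul_translate (hk : IsKernel k) {f : Eucl d → F}
    (hf : Integrable f) (x : Eucl d) : Integrable (fun t => k t • f (x - t)) := by
  obtain ⟨B, hB⟩ := hk.hasCompactSupport.exists_bound_of_continuous hk.contDiff.continuous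
  exact (hf.comp_sub_left x).bdd_smul B hk.contDiff.continuous.aestronglyMeasurable
    (Eventually.of_forall hB)

theorem kernelConv_eq_integral_sub (k : Eucl d → ℝ) (f : Eucl d → F) (x : Eucl d) :
    kernelConv k f x = ∫ y, k (x - y) • f y := by
  rw [kernelConv, ← integral_sub_left_eq_self _ volume x]
  simp

theorem IsKernel.norm_kernelConv_le (hk : IsKernel k) {B : ℝ} (hB : ∀ x, k x ≤ B)
    {f : Eucl d → F} (hf : Integrable f) (x : Eucl d) :
    ‖kernelConv k f x‖ ≤ B * ∫ y, ‖f y‖ := by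
  rw [kernelConv_eq_integral_sub, ← integral_const_mul]
  refine norm_integral_le_of_norm_le (hf.norm.const_mul B) (Eventually.of_forall fun y => ?_)
  rw [norm_smul, Real.norm_of_nonneg (hk.nonneg _)]
  gcongr
  exact hB _

theorem IsKernel.kernelConv_sub (hk : IsKernel k) [CompleteSpace F] {f : Eucl d → F}
    (hf : Integrable f) (x : Eucl d) :
    kernelConv k f x - f x = ∫ t, k t • (f (x - t) - f x) := by
  have h1 : ∫ t, k t • f x = f x := by
    rw [integral_smul_const, hk.integral_eq_one, one_smul]
  conv_lhs => rw [← h1]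
  rw [kernelConv, ← integral_sub (hk.integrable_smul_translate hf x) (hk.integrable.smul_const _)]
  simp_rw [smul_sub]

/-- The difference `k * f - f` is an average of translation differences of `f`; Tonelli moves the
`L¹` norm inside the average. -/
theorem IsKernel.lintegral_kernelConv_sub_le (hk : IsKernel k) [CompleteSpace F]
    {f : Eucl d → F} (hf : Integrable f) {η : ℝ≥0∞} {ρ : ℝ}
    (hη : ∀ t, ‖t‖ ≤ ρ → ∫⁻ x, ‖f (x - t) - f x‖ₑ ≤ η) (hs : ∀ t, k t ≠ 0 → ‖t‖ ≤ ρ) :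
    ∫⁻ x, ‖kernelConv k f x - f x‖ₑ ≤ η := by
  have hkm : AEMeasurable (fun p : Eucl d × Eucl d => ‖k p.2‖ₑ) (volume.prod volume) :=
    (hk.contDiff.continuous.comp continuous_snd).measurable.enorm.aemeasurable
  calc ∫⁻ x, ‖kernelConv k f x - f x‖ₑ
      ≤ ∫⁻ x, ∫⁻ t, ‖k t‖ₑ * ‖f (x - t) - f x‖ₑ := by
        refine lintegral_mono fun x => ?_
        rw [hk.kernelConv_sub hf x]
        refine (enorm_integral_le_lintegral_enorm _).trans_eq ?_
        simp_rw [enorm_smul]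
    _ = ∫⁻ t, ∫⁻ x, ‖k t‖ₑ * ‖f (x - t) - f x‖ₑ :=
        lintegral_lintegral_swap (hkm.mul (aestronglyMeasurable_translate_sub hf).enorm)
    _ = ∫⁻ t, ‖k t‖ₑ * ∫⁻ x, ‖f (x - t) - f x‖ₑ := by
        refine lintegral_congr fun t => lintegral_const_mul' _ _ enorm_ne_top
    _ ≤ ∫⁻ t, ‖k t‖ₑ * η := by
        refine lintegral_mono fun t => ?_
        by_cases ht : k t = 0
        · simp [ht]
        · gcongr
          exact hη t (hs t ht)
    _ = η := by
        rw [lintegral_mul_const _ hk.contDiff.continuous.measurable.enorm, hk.lintegral_enorm,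
          one_mul]

/-- The radius depends on `f` but not on the kernel, so one kernel can serve several functions at
once. -/
theorem exists_radius_lintegral_kernelConv_sub_le [CompleteSpace F] {f : Eucl d → F}
    (hf : Integrable f) {η : ℝ≥0∞} (hη : 0 < η) :
    ∃ ρ : ℝ, 0 < ρ ∧ ∀ k : Eucl d → ℝ, IsKernel k → (∀ t, k t ≠ 0 → ‖t‖ ≤ ρ) →
      ∫⁻ x, ‖kernelConv k f x - f x‖ₑ ≤ η := by
  have h := (tendsto_lintegral_enorm_translate_sub hf).eventually_le_const hη
  obtain ⟨ρ, hρ, hρη⟩ := Metric.nhds_basis_closedBall.eventually_iff.1 h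
  exact ⟨ρ, hρ, fun k hk hs => hk.lintegral_kernelConv_sub_le hf
    (fun t ht => hρη (by simpa using ht)) hs⟩

theorem IsKernel.contDiff_kernelConv (hk : IsKernel k) {u : Eucl d → ℝ} (hu : Integrable u) :
    ContDiff ℝ ((⊤ : ℕ∞) : WithTop ℕ∞) (kernelConv k u) :=
  hk.hasCompactSupport.contDiff_convolution_left (ContinuousLinearMap.lsmul ℝ ℝ) hk.contDiff
    hu.locallyIntegrable

theorem IsKernel.fderiv_kernelConv (hk : IsKernel k) {u : Eucl d → ℝ} (hu : Integrable u)
    (x z : Eucl d) :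
    fderiv ℝ (kernelConv k u) x z = ∫ y, u y * fderiv ℝ k (x - y) z := by
  have h1 : ContDiff ℝ 1 k := hk.contDiff.of_le (by exact_mod_cast le_top)
  have h := hk.hasCompactSupport.hasFDerivAt_convolution_left (ContinuousLinearMap.lsmul ℝ ℝ)
    h1 hu.locallyIntegrable x (μ := volume)
  have hex := (hk.hasCompactSupport.fderiv ℝ).convolutionExists_left
    ((ContinuousLinearMap.lsmul ℝ ℝ).precompL (Eucl d)) (h1.continuous_fderiv one_ne_zero)
    hu.locallyIntegrable x (μ := volume)
  change fderiv ℝ (convolution k u (ContinuousLinearMap.lsmul ℝ ℝ) volume) x z = _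
  rw [h.fderiv, convolution, ContinuousLinearMap.integral_apply hex]
  rw [← integral_sub_left_eq_self _ volume x]
  simp [mul_comm, ContinuousLinearMap.precompL]

end Kernel

/-! ### Weak gradients on the whole space -/

/-- `u ∈ W^{1,1}(ℝ^d)` with weak gradient `G`. -/
structure HasGlobalWeakGradient (u : Eucl d → ℝ) (G : Eucl d → Eucl d) : Prop where
  integrable : Integrable u
  integrable_grad : Integrable G
  integral_eq : ∀ ζ : Eucl d → ℝ, ContDiff ℝ ((⊤ : ℕ∞) : WithTop ℕ∞) ζ → HasCompactSupport ζ →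
    ∀ z, ∫ x, u x * fderiv ℝ ζ x z = -∫ x, ζ x * inner ℝ (G x) z

theorem inner_gradient_eq_fderiv {v : Eucl d → ℝ} {x : Eucl d} (h : DifferentiableAt ℝ v x)
    (z : Eucl d) : inner ℝ (gradient v x) z = fderiv ℝ v x z :=
  (h.hasGradientAt.fderiv_apply).symm

/-- The derivative falls on the kernel, and `y ↦ k (x - y)` is a test function for the weak
gradient; the sign from the reflection cancels the one from integration by parts. -/
theorem IsKernel.gradient_kernelConv {k : Eucl d → ℝ} (hk : IsKernel k) {u : Eucl d → ℝ}
    {G : Eucl d → Eucl d} (hu : HasGlobalWeakGradient u G) :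
    gradient (kernelConv k u) = kernelConv k G := by
  ext1 x
  refine ext_inner_right ℝ fun z => ?_
  have hdiff := (hk.contDiff_kernelConv hu.integrable).differentiable (by simp) x
  rw [inner_gradient_eq_fderiv hdiff, hk.fderiv_kernelConv hu.integrable]
  have hζ : ContDiff ℝ ((⊤ : ℕ∞) : WithTop ℕ∞) (fun y => k (x - y)) :=
    hk.contDiff.comp (contDiff_const.sub contDiff_id)
  have hζc : HasCompactSupport (fun y => k (x - y)) :=
    hk.hasCompactSupport.comp_homeomorph (Homeomorph.subLeft x)
  have h := hu.integral_eq _ hζ hζc z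
  have hfd : ∀ y, fderiv ℝ (fun y => k (x - y)) y z = - fderiv ℝ k (x - y) z := by
    intro y
    have h1 := ((hk.contDiff.differentiable (by simp) (x - y)).hasFDerivAt).comp y
      ((hasFDerivAt_const x y).sub (hasFDerivAt_id y))
    have h2 : fderiv ℝ (fun y => k (x - y)) y = _ := h1.fderiv
    rw [h2]
    simp
  simp_rw [hfd, mul_neg, integral_neg, neg_inj] at h
  have hint : Integrable fun y => k (x - y) • G y := by
    simpa using (hk.integrable_smul_translate hu.integrable_grad x).comp_sub_left x
  rw [h, kernelConv_eq_integral_sub, real_inner_comm, ← integral_inner hint]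
  refine integral_congr_ae (Eventually.of_forall fun y => ?_)
  simp only [real_inner_smul_right, real_inner_comm]

/-! ### Kernels supported in small balls -/

/-- A normalized bump at `δ • e` is at most the inverse volume of its inner ball, of radius `c * δ /
2`. Hence `B` depends only on `c` and `d`. -/
theorem exists_isKernel_of_ball {c : ℝ} (hc : 0 < c) :
    ∃ B : ℝ≥0, ∀ (e : Eucl d) (δ : ℝ), 0 < δ → ∃ k : Eucl d → ℝ, IsKernel k ∧
      (∀ x, k x ≤ B * δ ^ (-(d : ℤ))) ∧ ∀ t, k t ≠ 0 → ‖t - δ • e‖ ≤ c * δ := by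
  set b : ℝ := (c / 2) ^ d * volume.real (Metric.ball (0 : Eucl d) 1) with hb
  have hb0 : 0 < b := mul_pos (by positivity)
    (ENNReal.toReal_pos (Metric.measure_ball_pos _ _ one_pos).ne' measure_ball_lt_top.ne)
  refine ⟨⟨1 / b, by positivity⟩, fun e δ hδ => ?_⟩
  let f : ContDiffBump (δ • e) := ⟨c * δ / 2, c * δ, by positivity, by
    have := mul_pos hc hδ
    linarith⟩
  refine ⟨f.normed volume, ⟨f.contDiff_normed, f.hasCompactSupport_normed, f.nonneg_normed,
    f.integral_normed⟩, fun x => ?_, fun t ht => ?_⟩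
  · refine (f.normed_le_div_measure_closedBall_rIn volume x).trans_eq ?_
    have h1 : volume.real (Metric.closedBall (δ • e) f.rIn) = b * δ ^ d := by
      rw [Measure.addHaar_real_closedBall _ _ f.rIn_pos.le, finrank_euclideanSpace_fin, hb]
      change (c * δ / 2) ^ d * _ = _
      rw [show c * δ / 2 = (c / 2) * δ by ring, mul_pow]
      ring
    rw [h1, zpow_neg, zpow_natCast]
    change 1 / (b * δ ^ d) = 1 / b * (δ ^ d)⁻¹
    field_simp
  · have h : t ∈ Function.support (f.normed volume) := ht
    rw [f.support_normed_eq, Metric.mem_ball, dist_eq_norm] at h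
    exact h.le

/-! ### Translations into the domain -/

/-- Interior points need no preferred direction; at boundary points this is the uniform interior
cone condition. It covers `y ∈ closure Ω` so that a compact piece of the closure is moved into the
open set. -/
theorem HasLipschitzBoundary.exists_translate_mem {Ω : Set (Eucl d)} (hΩ : IsOpen Ω)
    (hΩL : HasLipschitzBoundary Ω) {x₀ : Eucl d} (hx₀ : x₀ ∈ closure Ω) :
    ∃ e : Eucl d, ‖e‖ ≤ 1 ∧ ∃ c : ℝ, 0 < c ∧ c ≤ 1 ∧ ∃ r > 0, ∀ δ : ℝ, 0 < δ → δ ≤ r →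
      ∀ y ∈ closure Ω, dist y x₀ ≤ r → ∀ z, ‖z - δ • e‖ ≤ c * δ → y + z ∈ Ω := by
  by_cases hx : x₀ ∈ Ω
  · obtain ⟨r, hr, hrΩ⟩ := Metric.isOpen_iff.1 hΩ x₀ hx
    refine ⟨0, by simp, 1, one_pos, le_rfl, r / 4, by positivity, fun δ _ hδr y _ hyr z hz => ?_⟩
    apply hrΩ
    rw [smul_zero, sub_zero, one_mul] at hz
    rw [Metric.mem_ball, dist_eq_norm, show y + z - x₀ = (y - x₀) + z by abel]
    rw [dist_eq_norm] at hyr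
    linarith [norm_add_le (y - x₀) z]
  · obtain ⟨e, he, K, g, hg, r, hr, hgr⟩ := hΩL x₀ ⟨hx₀, by rwa [hΩ.interior_eq]⟩
    have hK : (0 : ℝ) ≤ K := K.2
    -- A deviation `w` with `‖w‖ ≤ c * δ` raises the graph by at most `2 * K * c * δ`, while the
    -- height of the point grows by at least `δ - c * δ`. So `(2 * K + 1) * c < 1` is what is
    -- needed.
    set c : ℝ := 1 / (2 * K + 2) with hc
    have hc0 : 0 < c := by positivity
    have hcK : (2 * K + 2) * c = 1 := by rw [hc]; field_simp
    have hc1 : c ≤ 1 := by nlinarith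
    have hproj : Continuous fun x : Eucl d => x - inner ℝ e x • e := by fun_prop
    refine ⟨e, he.le, c, hc0, hc1, r / 4, by positivity, fun δ hδ hδr y hy hyr z hz => ?_⟩
    have hcδ : c * δ ≤ δ := by nlinarith
    have hz2 : ‖z‖ ≤ 2 * δ := by
      have h1 : ‖z‖ ≤ ‖z - δ • e‖ + ‖δ • e‖ := by simpa using norm_add_le (z - δ • e) (δ • e)
      rw [norm_smul, he, Real.norm_of_nonneg hδ.le] at h1
      linarith
    have hyz : y + z ∈ Metric.ball x₀ r := by
      rw [Metric.mem_ball, dist_eq_norm, show y + z - x₀ = (y - x₀) + z by abel]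
      rw [dist_eq_norm] at hyr
      linarith [norm_add_le (y - x₀) z]
    have hyb : y ∈ Metric.ball x₀ r := by
      rw [Metric.mem_ball]
      linarith
    rw [hgr _ hyz]
    have hyg : g (y - inner ℝ e y • e) ≤ inner ℝ e y := by
      have h1 : y ∈ closure (Metric.ball x₀ r ∩ Ω) :=
        Metric.isOpen_ball.inter_closure ⟨hyb, hy⟩
      have h2 : IsClosed {x : Eucl d | g (x - inner ℝ e x • e) ≤ inner ℝ e x} :=
        isClosed_le (hg.continuous.comp hproj) (by fun_prop)
      exact closure_minimal (fun x hx => ((hgr x hx.1).1 hx.2).le) h2 h1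
    set w := z - δ • e with hw
    have hz' : z = w + δ • e := by simp [hw]
    have hee : inner ℝ e e = (1 : ℝ) := by rw [real_inner_self_eq_norm_sq, he]; norm_num
    have hiw : |inner ℝ e w| ≤ ‖w‖ := by
      simpa [he] using abs_real_inner_le_norm e w
    have hdist : dist ((y + z) - inner ℝ e (y + z) • e) (y - inner ℝ e y • e) ≤ 2 * ‖w‖ := by
      rw [dist_eq_norm]
      have : (y + z) - inner ℝ e (y + z) • e - (y - inner ℝ e y • e) = w - inner ℝ e w • e := by
        rw [hz', inner_add_right, inner_add_right, inner_smul_right, hee]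
        module
      rw [this]
      refine (norm_sub_le _ _).trans ?_
      rw [norm_smul, he, mul_one, Real.norm_eq_abs]
      linarith
    have h1 := (abs_le.1 ((Real.dist_eq _ _).symm.le.trans
      (hg.dist_le_mul ((y + z) - inner ℝ e (y + z) • e) (y - inner ℝ e y • e)))).2
    have h2 : inner ℝ e (y + z) = inner ℝ e y + inner ℝ e w + δ := by
      rw [hz', inner_add_right, inner_add_right, inner_smul_right, hee]
      ring
    have h3 := (abs_le.1 hiw).1
    have h4 : (K : ℝ) * dist ((y + z) - inner ℝ e (y + z) • e) (y - inner ℝ e y • e)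
        ≤ K * (2 * (c * δ)) := by
      gcongr
      linarith
    have h5 : (2 * (K : ℝ) + 1) * (c * δ) < δ := by nlinarith
    refine lt_of_lt_of_eq ?_ h2.symm
    linarith

/-! ### Pointwise estimate of the convolution -/

variable {Ω : Set (Eucl d)} {Φ : Eucl d → ℝ≥0 → ℝ≥0∞}

theorem IsAdmissible.exists_kernelConv_le (hΦ : IsAdmissible Ω Φ) {G : Eucl d → Eucl d}
    (hG : Integrable G) (hG0 : ∀ x ∉ Ω, G x = 0) (B : ℝ≥0) :
    ∃ C : ℝ≥0, ∀ δ : ℝ, 0 < δ → 2 * δ ≤ 1 / 4 → ∀ k : Eucl d → ℝ, IsKernel k →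
      (∀ x, k x ≤ B * δ ^ (-(d : ℤ))) → (∀ t, k t ≠ 0 → ‖t‖ ≤ 2 * δ) → ∀ x ∈ Ω,
      Φ x ‖kernelConv k G x‖₊ ≤
        C * (1 + ∫⁻ t, ENNReal.ofReal (k t) * Ω.indicator (fun y => Φ y ‖G y‖₊) (x - t)) := by
  have hN0 : 0 ≤ ∫ y, ‖G y‖ := integral_nonneg fun y => norm_nonneg _
  set N : ℝ≥0 := ⟨∫ y, ‖G y‖, hN0⟩ with hN
  -- Dividing by `M` brings the convolution below `(2 * δ) ^ (-d)`, the range of the comparison at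
  -- radius `2 * δ`; `Δ₂` restores the factor `M` afterwards.
  set M : ℝ≥0 := max 1 (B * 2 ^ d * N) with hM
  have hM1 : 1 ≤ M := le_max_left _ _
  obtain ⟨c, -, hc⟩ := hΦ.exists_mul_le M
  obtain ⟨C₁, hC₁⟩ := hΦ.bounded 1
  obtain ⟨C₂, hC₂⟩ := hΦ.comparison
  refine ⟨c * (C₁ + C₂), fun δ hδ hδ4 k hk hkB hks x hx => ?_⟩
  set I := ∫⁻ t, ENNReal.ofReal (k t) * Ω.indicator (fun y => Φ y ‖G y‖₊) (x - t) with hI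
  set T := ‖kernelConv k G x‖₊ with hT
  have hTM : T = M * (T / M) := (mul_div_cancel₀ T (zero_lt_one.trans_le hM1).ne').symm
  have hTle : T / M ≤ T := div_le_self zero_le hM1
  have key : Φ x (T / M) ≤ C₁ + C₂ * I := by
    -- Arguments at most `1` are outside the range of the comparison and are covered by the bound on
    -- `Φ x 1`; they produce the summand `1` in the estimate.
    rcases le_total (T / M) 1 with h1 | h1
    · exact ((hΦ.monotone hx h1).trans (hC₁ x hx)).trans le_self_add
    have hδd : (0 : ℝ) < (2 * δ) ^ (-(d : ℤ)) := by positivity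
    have hbound : ((T / M : ℝ≥0) : ℝ) ≤ (2 * δ) ^ (-(d : ℤ)) := by
      rw [NNReal.coe_div, div_le_iff₀ (by exact_mod_cast zero_lt_one.trans_le hM1)]
      have h2 : (T : ℝ) ≤ B * δ ^ (-(d : ℤ)) * N := hk.norm_kernelConv_le hkB hG x
      have h3 : ((B * 2 ^ d * N : ℝ≥0) : ℝ) ≤ M := NNReal.coe_le_coe.2 (le_max_right _ _)
      push_cast at h3
      calc (T : ℝ) ≤ B * δ ^ (-(d : ℤ)) * N := h2
        _ = (2 * δ) ^ (-(d : ℤ)) * (B * 2 ^ d * N) := by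
          rw [zpow_neg, zpow_neg, zpow_natCast, zpow_natCast, mul_pow]
          field_simp
        _ ≤ _ := by gcongr
    obtain ⟨Λ, hΛ, hΛ0, hΛfin, hΛx, hΛy⟩ := hC₂ x hx (2 * δ) (by positivity) hδ4 _ h1 hbound
    have hJ : Λ T ≤ I := by
      refine (convexOn_nnnorm_integral_le hΛ hΛ0 hΛfin hk.nonneg hk.integrable hk.integral_eq_one
        (hG.comp_sub_left x).1 (hk.integrable_smul_translate hG x)).trans ?_
      refine lintegral_mono fun t => ?_
      by_cases ht : k t = 0
      · simp [ht]
      gcongr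
      by_cases hxt : x - t ∈ Ω
      · rw [Set.indicator_of_mem hxt]
        exact hΛy _ hxt (by simpa [dist_eq_norm] using hks t ht) _
      · simp [hG0 _ hxt, hΛ0]
    calc Φ x (T / M) ≤ C₂ * Λ (T / M) := hΛx
      _ ≤ C₂ * I := by
        gcongr
        exact (monotone_of_convexOn hΛ hΛ0 hTle).trans hJ
      _ ≤ C₁ + C₂ * I := le_add_self
  calc Φ x T = Φ x (M * (T / M)) := by rw [← hTM]
    _ ≤ c * Φ x (T / M) := hc x hx _
    _ ≤ c * (C₁ + C₂ * I) := by gcongr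
    _ ≤ c * ((C₁ + C₂) * (1 + I)) := by
        gcongr
        calc (C₁ : ℝ≥0∞) + C₂ * I ≤ C₁ + C₂ * I + (C₂ + C₁ * I) := le_self_add
          _ = (C₁ + C₂) * (1 + I) := by ring
    _ = ((c * (C₁ + C₂) : ℝ≥0) : ℝ≥0∞) * (1 + I) := by push_cast; ring

/-! ### Sequences which converge fast -/

theorem lintegral_tsum_lt_top_of_le_geometric {α : Type*} [MeasurableSpace α] {μ : Measure α}
    {g : ℕ → α → ℝ≥0∞} (hg : ∀ n, AEMeasurable (g n) μ)
    (hle : ∀ n, ∫⁻ x, g n x ∂μ ≤ (2⁻¹ : ℝ≥0∞) ^ n) : ∫⁻ x, ∑' n, g n x ∂μ < ∞ := by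
  rw [lintegral_tsum hg]
  refine (ENNReal.tsum_le_tsum hle).trans_lt ?_
  rw [ENNReal.tsum_geometric]
  simp

theorem ae_tendsto_zero_of_le_geometric {α : Type*} [MeasurableSpace α] {μ : Measure α}
    {g : ℕ → α → ℝ≥0∞} (hg : ∀ n, AEMeasurable (g n) μ)
    (hle : ∀ n, ∫⁻ x, g n x ∂μ ≤ (2⁻¹ : ℝ≥0∞) ^ n) :
    ∀ᵐ x ∂μ, Tendsto (fun n => g n x) atTop (𝓝 0) := by
  have h := ae_lt_top' (AEMeasurable.tsum hg)
    (lintegral_tsum_lt_top_of_le_geometric hg hle).ne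
  filter_upwards [h] with x hx
  exact ENNReal.tendsto_atTop_zero_of_tsum_ne_top hx.ne

theorem tendsto_inv_two_pow : Tendsto (fun n : ℕ => (2⁻¹ : ℝ≥0∞) ^ n) atTop (𝓝 0) :=
  ENNReal.tendsto_pow_atTop_nhds_zero_of_lt_one (by simp)

/-! ### Approximable functions -/

/-- `u` can be approximated by test functions in `W^{1,1}(Ω)` such that the modular of the
difference of the gradients is small. -/
def Approximable (Ω : Set (Eucl d)) (Φ : Eucl d → ℝ≥0 → ℝ≥0∞) (u : Eucl d → ℝ)
    (G : Eucl d → Eucl d) : Prop :=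
  ∀ η : ℝ≥0∞, 0 < η → ∃ v, IsTestFunction Ω v ∧ ∫⁻ x in Ω, ‖v x - u x‖ₑ ≤ η ∧
    ∫⁻ x in Ω, ‖gradient v x - G x‖ₑ ≤ η ∧ modular Ω Φ (fun x => gradient v x - G x) ≤ η

theorem Approximable.of_tendsto {u : Eucl d → ℝ} {G : Eucl d → Eucl d} {v : ℕ → Eucl d → ℝ}
    (hv : ∀ n, IsTestFunction Ω (v n))
    (h1 : Tendsto (fun n => ∫⁻ x in Ω, ‖v n x - u x‖ₑ) atTop (𝓝 0))
    (h2 : Tendsto (fun n => ∫⁻ x in Ω, ‖gradient (v n) x - G x‖ₑ) atTop (𝓝 0))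
    (h3 : Tendsto (fun n => modular Ω Φ (fun x => gradient (v n) x - G x)) atTop (𝓝 0)) :
    Approximable Ω Φ u G := by
  intro η hη
  obtain ⟨n, hn1, hn2, hn3⟩ := ((h1.eventually_le_const hη).and
    ((h2.eventually_le_const hη).and (h3.eventually_le_const hη))).exists
  exact ⟨v n, hv n, hn1, hn2, hn3⟩

theorem continuous_gradient_of_contDiff {v : Eucl d → ℝ}
    (hv : ContDiff ℝ ((⊤ : ℕ∞) : WithTop ℕ∞) v) : Continuous (gradient v) :=
  (LinearIsometryEquiv.continuous _).comp (hv.continuous_fderiv (by simp))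

open scoped Pointwise in
/-- A function with small support, near which the domain admits small translations into
itself, can be approximated by convolution. -/
theorem Approximable.of_translate_mem (hΦ : IsAdmissible Ω Φ) (hΩ : IsOpen Ω)
    (hΩfin : volume Ω < ∞) {u : Eucl d → ℝ} {G : Eucl d → Eucl d}
    (hu : HasGlobalWeakGradient u G) (hmod : modular Ω Φ G < ∞)
    {e x₀ : Eucl d} {c r : ℝ} (he : ‖e‖ ≤ 1) (hc : 0 < c) (hc1 : c ≤ 1) (hr : 0 < r)
    (htr : ∀ δ : ℝ, 0 < δ → δ ≤ r →
      ∀ y ∈ closure Ω, dist y x₀ ≤ r → ∀ z, ‖z - δ • e‖ ≤ c * δ → y + z ∈ Ω)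
    (hu0 : ∀ x, ¬ (x ∈ Ω ∧ dist x x₀ ≤ r) → u x = 0)
    (hG0 : ∀ x ∉ Ω, G x = 0) : Approximable Ω Φ u G := by
  set θ : Eucl d → ℝ≥0∞ := Ω.indicator (fun y => Φ y ‖G y‖₊) with hθ
  have hθfin : ∀ x, θ x ≠ ∞ := by
    intro x
    by_cases hx : x ∈ Ω
    · obtain ⟨C, hC⟩ := hΦ.bounded ‖G x‖₊
      rw [hθ, Set.indicator_of_mem hx]
      exact ((hC x hx).trans_lt ENNReal.coe_lt_top).ne
    · simp [hθ, hx]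
  have hΦm : ∀ {f : Eucl d → Eucl d}, AEStronglyMeasurable f (volume.restrict Ω) →
      AEMeasurable (fun x => Φ x ‖f x‖₊) (volume.restrict Ω) := fun hf =>
    hΦ.aemeasurable _ hf.nnnorm.aemeasurable
  have hθm : AEMeasurable θ volume :=
    (aemeasurable_indicator_iff hΩ.measurableSet).2 (hΦm hu.integrable_grad.1.restrict)
  have hθint : ∫⁻ x, θ x ≠ ∞ := by
    rw [hθ, lintegral_indicator hΩ.measurableSet]
    exact hmod.ne
  -- The energy density as a real function, so that it too can be convolved.
  set h : Eucl d → ℝ := fun x => (θ x).toReal with hh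
  have hhθ : ∀ x, ENNReal.ofReal (h x) = θ x := fun x => ENNReal.ofReal_toReal (hθfin x)
  have hhi : Integrable h := integrable_toReal_of_lintegral_ne_top hθm hθint
  obtain ⟨B, hB⟩ := exists_isKernel_of_ball (d := d) hc
  have hpos : ∀ n : ℕ, (0 : ℝ≥0∞) < 2⁻¹ ^ n := fun n =>
    ENNReal.pow_pos (ENNReal.inv_pos.2 ENNReal.ofNat_ne_top) n
  choose ρ₁ hρ₁ hρ₁' using fun n => exists_radius_lintegral_kernelConv_sub_le hu.integrable (hpos n)
  choose ρ₂ hρ₂ hρ₂' using fun n =>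
    exists_radius_lintegral_kernelConv_sub_le hu.integrable_grad (hpos n)
  choose ρ₃ hρ₃ hρ₃' using fun n => exists_radius_lintegral_kernelConv_sub_le hhi (hpos n)
  -- One `δ` makes the `L¹` errors of `u`, `G` and `h` all at most `2⁻¹ ^ n`. Summability of these
  -- errors gives a.e. convergence of the gradients and an integrable majorant along the whole
  -- sequence.
  have hδex : ∀ n, ∃ δ : ℝ, 0 < δ ∧ δ ≤ r ∧ 2 * δ ≤ 1 / 4 ∧ 2 * δ ≤ ρ₁ n ∧ 2 * δ ≤ ρ₂ n ∧
      2 * δ ≤ ρ₃ n := by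
    intro n
    have := hρ₁ n
    have := hρ₂ n
    have := hρ₃ n
    refine ⟨min r (min (1 / 8) (min (ρ₁ n / 2) (min (ρ₂ n / 2) (ρ₃ n / 2)))), by positivity,
      min_le_left _ _, ?_⟩
    set m := min r (min (1 / 8) (min (ρ₁ n / 2) (min (ρ₂ n / 2) (ρ₃ n / 2)))) with hm
    have hle : m ≤ min (1 / 8) (min (ρ₁ n / 2) (min (ρ₂ n / 2) (ρ₃ n / 2))) := min_le_right _ _
    simp only [le_min_iff] at hle
    refine ⟨?_, ?_, ?_, ?_⟩ <;> linarith [hle.1, hle.2.1, hle.2.2.1, hle.2.2.2]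
  choose δ hδ0 hδr hδ4 hδ₁ hδ₂ hδ₃ using hδex
  choose k hk hkB hks using fun n => hB e (δ n) (hδ0 n)
  have hks2 : ∀ n t, k n t ≠ 0 → ‖t‖ ≤ 2 * δ n := by
    intro n t ht
    have h1 : ‖t‖ ≤ ‖t - δ n • e‖ + ‖δ n • e‖ := by
      simpa using norm_add_le (t - δ n • e) (δ n • e)
    rw [norm_smul, Real.norm_of_nonneg (hδ0 n).le] at h1
    have := hks n t ht
    have := hδ0 n
    nlinarith
  have e1 : ∀ n, ∫⁻ x, ‖kernelConv (k n) u x - u x‖ₑ ≤ 2⁻¹ ^ n := fun n =>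
    hρ₁' n _ (hk n) fun t ht => (hks2 n t ht).trans (hδ₁ n)
  have e2 : ∀ n, ∫⁻ x, ‖kernelConv (k n) G x - G x‖ₑ ≤ 2⁻¹ ^ n := fun n =>
    hρ₂' n _ (hk n) fun t ht => (hks2 n t ht).trans (hδ₂ n)
  have e3 : ∀ n, ∫⁻ x, ‖kernelConv (k n) h x - h x‖ₑ ≤ 2⁻¹ ^ n := fun n =>
    hρ₃' n _ (hk n) fun t ht => (hks2 n t ht).trans (hδ₃ n)
  have hgrad : ∀ n, gradient (kernelConv (k n) u) = kernelConv (k n) G := fun n =>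
    (hk n).gradient_kernelConv hu
  have htest : ∀ n, IsTestFunction Ω (kernelConv (k n) u) := by
    intro n
    set K := (closure Ω ∩ Metric.closedBall x₀ r) with hK
    have hKc : IsCompact K := (isCompact_closedBall x₀ r).inter_left isClosed_closure
    have hKK : IsCompact (K + Metric.closedBall (δ n • e) (c * δ n)) :=
      hKc.add (isCompact_closedBall _ _)
    have hKΩ : K + Metric.closedBall (δ n • e) (c * δ n) ⊆ Ω := by
      rintro _ ⟨y, hy, z, hz, rfl⟩
      exact htr _ (hδ0 n) (hδr n) y hy.1 hy.2 z (by simpa [dist_eq_norm] using hz)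
    -- A nonzero integrand forces `x = (x - t) + t`, with `x - t` in the support region of `u` and
    -- `t` in that of the kernel.
    have hsupp : ∀ x, x ∉ K + Metric.closedBall (δ n • e) (c * δ n) →
        kernelConv (k n) u x = 0 := by
      intro x hx
      refine integral_eq_zero_of_ae (Eventually.of_forall fun t => ?_)
      by_cases ht : k n t = 0
      · simp [ht]
      by_cases hxt : x - t ∈ Ω ∧ dist (x - t) x₀ ≤ r
      · exact (hx ⟨x - t, ⟨subset_closure hxt.1, hxt.2⟩, t,
          by simpa [dist_eq_norm] using hks n t ht, by simp⟩).elim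
      · simp [hu0 _ hxt]
    refine ⟨(hk n).contDiff_kernelConv hu.integrable, HasCompactSupport.intro hKK hsupp, ?_⟩
    refine (closure_minimal (fun x hx => ?_) hKK.isClosed).trans hKΩ
    by_contra hcon
    exact hx (hsupp x hcon)
  have hGm : ∀ n, AEStronglyMeasurable (fun x => kernelConv (k n) G x - G x) volume := fun n => by
    rw [← hgrad n]
    exact (continuous_gradient_of_contDiff (htest n).1).aestronglyMeasurable.sub
      hu.integrable_grad.1
  have hhm : ∀ n, AEStronglyMeasurable (fun x => kernelConv (k n) h x - h x) volume := fun n =>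
    ((hk n).contDiff_kernelConv hhi).continuous.aestronglyMeasurable.sub hhi.1
  refine Approximable.of_tendsto htest ?_ ?_ ?_
  · exact tendsto_of_tendsto_of_tendsto_of_le_of_le tendsto_const_nhds tendsto_inv_two_pow
      (fun n => zero_le) fun n => (setLIntegral_le_lintegral _ _).trans (e1 n)
  · simp_rw [hgrad]
    exact tendsto_of_tendsto_of_tendsto_of_le_of_le tendsto_const_nhds tendsto_inv_two_pow
      (fun n => zero_le) fun n => (setLIntegral_le_lintegral _ _).trans (e2 n)
  simp_rw [hgrad]
  obtain ⟨C, hC⟩ := hΦ.exists_kernelConv_le hu.integrable_grad hG0 B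
  obtain ⟨c', -, hc'⟩ := hΦ.exists_add_le
  -- The sum `S` of all errors dominates each convolution of `h` by `θ + S`, independently of `n`.
  have hS := lintegral_tsum_lt_top_of_le_geometric (fun n => (hhm n).enorm) e3
  set S : Eucl d → ℝ≥0∞ := fun x => ∑' n, ‖kernelConv (k n) h x - h x‖ₑ with hSdef
  have hconv : ∀ n x, x ∈ Ω → Φ x ‖kernelConv (k n) G x‖₊ ≤ C * (1 + (θ x + S x)) := by
    intro n x hx
    refine (hC (δ n) (hδ0 n) (hδ4 n) (k n) (hk n) (hkB n) (hks2 n) x hx).trans ?_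
    gcongr
    have h1 : ∫⁻ t, ENNReal.ofReal (k n t) * θ (x - t) = ENNReal.ofReal (kernelConv (k n) h x) := by
      rw [kernelConv, ofReal_integral_eq_lintegral_ofReal ((hk n).integrable_smul_translate hhi x)
        (Eventually.of_forall fun t => mul_nonneg ((hk n).nonneg t) ENNReal.toReal_nonneg)]
      refine lintegral_congr fun t => ?_
      rw [smul_eq_mul, ENNReal.ofReal_mul ((hk n).nonneg t), hhθ]
    rw [h1]
    calc ENNReal.ofReal (kernelConv (k n) h x)
        ≤ ENNReal.ofReal (h x + ‖kernelConv (k n) h x - h x‖) := by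
          refine ENNReal.ofReal_le_ofReal ?_
          linarith [Real.le_norm_self (kernelConv (k n) h x - h x)]
      _ ≤ θ x + ‖kernelConv (k n) h x - h x‖ₑ := by
          refine ENNReal.ofReal_add_le.trans ?_
          rw [hhθ, ofReal_norm]
      _ ≤ θ x + S x := by
          gcongr
          exact ENNReal.le_tsum n
  have hlim := tendsto_lintegral_of_dominated_convergence' (μ := volume.restrict Ω)
    (F := fun n x => Φ x ‖kernelConv (k n) G x - G x‖₊) (f := fun _ => 0)
    (fun x => c' * (C * (1 + (θ x + S x)) + θ x)) (fun n => hΦm (hGm n).restrict) ?_ ?_ ?_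
  · simpa [modular] using hlim
  · intro n
    filter_upwards [ae_restrict_mem hΩ.measurableSet] with x hx
    calc Φ x ‖kernelConv (k n) G x - G x‖₊
        ≤ Φ x (‖kernelConv (k n) G x‖₊ + ‖G x‖₊) := hΦ.monotone hx (nnnorm_sub_le _ _)
      _ ≤ c' * (Φ x ‖kernelConv (k n) G x‖₊ + Φ x ‖G x‖₊) := hc' x hx _ _
      _ ≤ c' * (C * (1 + (θ x + S x)) + θ x) := by
          gcongr
          · exact hconv n x hx
          · rw [hθ, Set.indicator_of_mem hx]
  · have hSm : AEMeasurable S volume := AEMeasurable.tsum fun n => (hhm n).enorm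
    rw [lintegral_const_mul' _ _ ENNReal.coe_ne_top, lintegral_add_right' _ hθm.restrict,
      lintegral_const_mul' _ _ ENNReal.coe_ne_top, lintegral_add_left measurable_const,
      lintegral_add_left' hθm.restrict, lintegral_const, Measure.restrict_apply_univ]
    have hθΩ : ∫⁻ x in Ω, θ x ≠ ∞ :=
      ((setLIntegral_le_lintegral _ _).trans_lt hθint.lt_top).ne
    have hSΩ : ∫⁻ x in Ω, S x ≠ ∞ := ((setLIntegral_le_lintegral _ _).trans_lt hS).ne
    finiteness
  · have hae := ae_tendsto_zero_of_le_geometric (fun n => (hGm n).enorm) e2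
    filter_upwards [ae_restrict_mem hΩ.measurableSet, ae_restrict_of_ae hae] with x hx hxt
    refine (hΦ.tendsto_zero x hx).comp ?_
    have : Tendsto (fun n => ((‖kernelConv (k n) G x - G x‖₊ : ℝ≥0) : ℝ≥0∞)) atTop
      (𝓝 ((0 : ℝ≥0) : ℝ≥0∞)) := hxt
    exact ENNReal.tendsto_coe.1 this

/-! ### Gradients -/

theorem gradient_add {f g : Eucl d → ℝ} {x : Eucl d} (hf : DifferentiableAt ℝ f x)
    (hg : DifferentiableAt ℝ g x) :
    gradient (fun y => f y + g y) x = gradient f x + gradient g x := by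
  simp [gradient, fderiv_fun_add hf hg]

theorem gradient_sum {ι : Type*} (s : Finset ι) {f : ι → Eucl d → ℝ} {x : Eucl d}
    (hf : ∀ i ∈ s, DifferentiableAt ℝ (f i) x) :
    gradient (fun y => ∑ i ∈ s, f i y) x = ∑ i ∈ s, gradient (f i) x := by
  simp [gradient, fderiv_fun_sum hf]

theorem gradient_comp_smul {f : Eucl d → ℝ} (hf : Differentiable ℝ f) (s : ℝ) (x : Eucl d) :
    gradient (fun y => f (s • y)) x = s • gradient f (s • x) := by
  refine ext_inner_right ℝ fun z => ?_
  have h : HasFDerivAt (fun y => f (s • y)) _ x :=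
    (hf (s • x)).hasFDerivAt.comp x ((hasFDerivAt_id x).const_smul s)
  rw [inner_gradient_eq_fderiv h.differentiableAt, h.fderiv, real_inner_smul_left,
    inner_gradient_eq_fderiv (hf _)]
  simp

theorem gradient_real_comp {f : Eucl d → ℝ} {T : ℝ → ℝ} {T' : ℝ} {x : Eucl d}
    (hf : DifferentiableAt ℝ f x) (hT : HasDerivAt T T' (f x)) :
    gradient (fun y => T (f y)) x = T' • gradient f x := by
  refine ext_inner_right ℝ fun z => ?_
  have h : HasFDerivAt (fun y => T (f y)) _ x := hT.comp_hasFDerivAt x hf.hasFDerivAt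
  rw [inner_gradient_eq_fderiv h.differentiableAt, h.fderiv, real_inner_smul_left,
    inner_gradient_eq_fderiv hf]
  simp

theorem gradient_eq_zero_of_notMem_tsupport {f : Eucl d → ℝ} {x : Eucl d} (hx : x ∉ tsupport f) :
    gradient f x = 0 := by
  have h : fderiv ℝ f x = 0 := by
    by_contra hne
    exact hx (support_fderiv_subset ℝ hne)
  simp [gradient, h]

theorem hasCompactSupport_gradient {f : Eucl d → ℝ} (hf : HasCompactSupport f) :
    HasCompactSupport (gradient f) :=
  HasCompactSupport.intro hf fun _ => gradient_eq_zero_of_notMem_tsupport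

theorem exists_norm_gradient_le {f : Eucl d → ℝ} (hf : ContDiff ℝ ((⊤ : ℕ∞) : WithTop ℕ∞) f)
    (hfc : HasCompactSupport f) : ∃ L : ℝ≥0, ∀ x, ‖gradient f x‖ ≤ L := by
  obtain ⟨L, hL⟩ := (hasCompactSupport_gradient hfc).exists_bound_of_continuous
    (continuous_gradient_of_contDiff hf)
  exact ⟨L.toNNReal, fun x => (hL x).trans (Real.le_coe_toNNReal L)⟩

/-! ### Sums and limits of approximable functions -/

theorem IsAdmissible.exists_modular_add_le (hΦ : IsAdmissible Ω Φ) (hΩ : IsOpen Ω) :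
    ∃ c : ℝ≥0, 1 ≤ c ∧ ∀ f g : Eucl d → Eucl d, AEStronglyMeasurable f (volume.restrict Ω) →
      modular Ω Φ (fun x => f x + g x) ≤ c * (modular Ω Φ f + modular Ω Φ g) := by
  obtain ⟨c, hc1, hc⟩ := hΦ.exists_add_le
  refine ⟨c, hc1, fun f g hf => ?_⟩
  unfold modular
  rw [← lintegral_add_left' (hΦ.aemeasurable _ hf.nnnorm.aemeasurable),
    ← lintegral_const_mul' _ _ ENNReal.coe_ne_top]
  refine setLIntegral_mono' hΩ.measurableSet fun x hx => ?_
  exact (hΦ.monotone hx (nnnorm_add_le _ _)).trans (hc x hx _ _)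

theorem exists_pos_mul_add_le {c : ℝ≥0} {η : ℝ≥0∞} (hη : 0 < η) :
    ∃ ε : ℝ≥0∞, 0 < ε ∧ (c : ℝ≥0∞) * (ε + ε) ≤ η := by
  refine ⟨η / (c * 2), ENNReal.div_pos hη.ne' (by finiteness), ?_⟩
  rw [← mul_two, mul_comm _ (2 : ℝ≥0∞), ← mul_assoc]
  exact ENNReal.mul_div_le

theorem lintegral_enorm_add_le_of_le {F : Type*} [NormedAddCommGroup F] {μ : Measure (Eucl d)}
    {f g : Eucl d → F} (hf : AEStronglyMeasurable f μ) {c : ℝ≥0} (hc : 1 ≤ c) {ε η : ℝ≥0∞}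
    (hε : (c : ℝ≥0∞) * (ε + ε) ≤ η) (hfε : ∫⁻ x, ‖f x‖ₑ ∂μ ≤ ε) (hgε : ∫⁻ x, ‖g x‖ₑ ∂μ ≤ ε) :
    ∫⁻ x, ‖f x + g x‖ₑ ∂μ ≤ η := by
  calc ∫⁻ x, ‖f x + g x‖ₑ ∂μ ≤ ∫⁻ x, (‖f x‖ₑ + ‖g x‖ₑ) ∂μ :=
        lintegral_mono fun x => enorm_add_le _ _
    _ ≤ ε + ε := by
        rw [lintegral_add_left' hf.enorm]
        gcongr
    _ = 1 * (ε + ε) := (one_mul _).symm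
    _ ≤ c * (ε + ε) := by gcongr; exact_mod_cast hc
    _ ≤ η := hε

theorem IsTestFunction.aestronglyMeasurable_sub {v u : Eucl d → ℝ} (hv : IsTestFunction Ω v)
    (hu : Integrable u) : AEStronglyMeasurable (fun x => v x - u x) (volume.restrict Ω) :=
  hv.1.continuous.aestronglyMeasurable.sub hu.1.restrict

theorem IsTestFunction.aestronglyMeasurable_gradient_sub {v : Eucl d → ℝ} {G : Eucl d → Eucl d}
    (hv : IsTestFunction Ω v) (hG : Integrable G) :
    AEStronglyMeasurable (fun x => gradient v x - G x) (volume.restrict Ω) :=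
  (continuous_gradient_of_contDiff hv.1).aestronglyMeasurable.sub hG.1.restrict

theorem Approximable.add (hΦ : IsAdmissible Ω Φ) (hΩ : IsOpen Ω) {u₁ u₂ : Eucl d → ℝ}
    {G₁ G₂ : Eucl d → Eucl d} (hu₁ : Integrable u₁) (hG₁ : Integrable G₁)
    (h₁ : Approximable Ω Φ u₁ G₁) (h₂ : Approximable Ω Φ u₂ G₂) :
    Approximable Ω Φ (fun x => u₁ x + u₂ x) (fun x => G₁ x + G₂ x) := by
  obtain ⟨c, hc1, hc⟩ := hΦ.exists_modular_add_le hΩ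
  intro η hη
  obtain ⟨ε, hε, hεη⟩ := exists_pos_mul_add_le (c := c) hη
  obtain ⟨v₁, hv₁, a₁, b₁, m₁⟩ := h₁ ε hε
  obtain ⟨v₂, hv₂, a₂, b₂, m₂⟩ := h₂ ε hε
  have hsupp : tsupport (fun x => v₁ x + v₂ x) ⊆ Ω :=
    (tsupport_add v₁ v₂).trans (Set.union_subset hv₁.2.2 hv₂.2.2)
  have hgrad : ∀ x, gradient (fun x => v₁ x + v₂ x) x - (G₁ x + G₂ x) =
      (gradient v₁ x - G₁ x) + (gradient v₂ x - G₂ x) := by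
    intro x
    rw [gradient_add (hv₁.1.differentiable (by simp) x) (hv₂.1.differentiable (by simp) x)]
    abel
  refine ⟨fun x => v₁ x + v₂ x, ⟨hv₁.1.add hv₂.1, hv₁.2.1.add hv₂.2.1, hsupp⟩, ?_, ?_, ?_⟩
  · simp_rw [add_sub_add_comm]
    exact lintegral_enorm_add_le_of_le (hv₁.aestronglyMeasurable_sub hu₁) hc1 hεη a₁ a₂
  · simp_rw [hgrad]
    exact lintegral_enorm_add_le_of_le (hv₁.aestronglyMeasurable_gradient_sub hG₁) hc1 hεη b₁ b₂
  · simp_rw [hgrad]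
    refine (hc _ _ (hv₁.aestronglyMeasurable_gradient_sub hG₁)).trans (le_trans ?_ hεη)
    gcongr

theorem isTestFunction_zero : IsTestFunction Ω (fun _ => 0) :=
  ⟨contDiff_const, HasCompactSupport.zero, by simp⟩

theorem Approximable.zero (hΦ : IsAdmissible Ω Φ) (hΩ : IsOpen Ω) :
    Approximable Ω Φ (fun _ => 0) (fun _ => 0) := by
  intro η _
  have hgrad : ∀ x : Eucl d, gradient (fun _ : Eucl d => (0 : ℝ)) x = 0 := fun x => by
    simp [gradient]
  refine ⟨fun _ => 0, isTestFunction_zero, by simp, by simp [hgrad], ?_⟩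
  have : modular Ω Φ (fun x => gradient (fun _ : Eucl d => (0 : ℝ)) x - 0) = 0 := by
    unfold modular
    refine setLIntegral_eq_zero hΩ.measurableSet fun x hx => ?_
    simp [hgrad, hΦ.map_zero x hx]
  exact this.le.trans zero_le

theorem Approximable.sum (hΦ : IsAdmissible Ω Φ) (hΩ : IsOpen Ω) {ι : Type*} (s : Finset ι)
    {u : ι → Eucl d → ℝ} {G : ι → Eucl d → Eucl d} (hu : ∀ i, Integrable (u i))
    (hG : ∀ i, Integrable (G i)) (h : ∀ i, Approximable Ω Φ (u i) (G i)) :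
    Approximable Ω Φ (fun x => ∑ i ∈ s, u i x) (fun x => ∑ i ∈ s, G i x) := by
  classical
  induction s using Finset.induction_on with
  | empty => simpa using Approximable.zero hΦ hΩ
  | insert i s his ih =>
    simp_rw [Finset.sum_insert his]
    exact Approximable.add hΦ hΩ (hu i) (hG i) (h i) ih

theorem Approximable.congr (hΩ : IsOpen Ω) {u u' : Eucl d → ℝ} {G G' : Eucl d → Eucl d}
    (h : Approximable Ω Φ u G) (hu : ∀ x ∈ Ω, u x = u' x) (hG : ∀ x ∈ Ω, G x = G' x) :
    Approximable Ω Φ u' G' := by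
  intro η hη
  obtain ⟨v, hv, a, b, m⟩ := h η hη
  refine ⟨v, hv, a.trans_eq' ?_, b.trans_eq' ?_, m.trans_eq' ?_⟩
  · exact setLIntegral_congr_fun hΩ.measurableSet fun x hx => by simp [hu x hx]
  · exact setLIntegral_congr_fun hΩ.measurableSet fun x hx => by simp [hG x hx]
  · exact setLIntegral_congr_fun hΩ.measurableSet fun x hx => by simp [hG x hx]

/-- A diagonal argument; the triangle inequality for the modular holds up to a factor by `Δ₂`. -/
theorem Approximable.of_limit (hΦ : IsAdmissible Ω Φ) (hΩ : IsOpen Ω) {u : Eucl d → ℝ}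
    {G : Eucl d → Eucl d} {w : ℕ → Eucl d → ℝ} {H : ℕ → Eucl d → Eucl d}
    (hw : ∀ n, Integrable (w n)) (hH : ∀ n, Integrable (H n))
    (h : ∀ n, Approximable Ω Φ (w n) (H n))
    (h1 : Tendsto (fun n => ∫⁻ x in Ω, ‖w n x - u x‖ₑ) atTop (𝓝 0))
    (h2 : Tendsto (fun n => ∫⁻ x in Ω, ‖H n x - G x‖ₑ) atTop (𝓝 0))
    (h3 : Tendsto (fun n => modular Ω Φ (fun x => H n x - G x)) atTop (𝓝 0)) :
    Approximable Ω Φ u G := by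
  obtain ⟨c, hc1, hc⟩ := hΦ.exists_modular_add_le hΩ
  intro η hη
  obtain ⟨ε, hε, hεη⟩ := exists_pos_mul_add_le (c := c) hη
  obtain ⟨n, hn1, hn2, hn3⟩ := ((h1.eventually_le_const hε).and
    ((h2.eventually_le_const hε).and (h3.eventually_le_const hε))).exists
  obtain ⟨v, hv, a, b, m⟩ := h n ε hε
  refine ⟨v, hv, ?_, ?_, ?_⟩
  · simpa using lintegral_enorm_add_le_of_le (hv.aestronglyMeasurable_sub (hw n)) hc1 hεη a hn1
  · simpa using
      lintegral_enorm_add_le_of_le (hv.aestronglyMeasurable_gradient_sub (hH n)) hc1 hεη b hn2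
  · have h4 := hc _ (fun x => H n x - G x) (hv.aestronglyMeasurable_gradient_sub (hH n))
    simp only [sub_add_sub_cancel] at h4
    refine h4.trans (le_trans ?_ hεη)
    gcongr

/-! ### Multiplication by cutoff functions -/

/-- The product `χ * ζ` is inserted as the test function, and the Leibniz rule is rearranged. -/
theorem HasGlobalWeakGradient.mul {u : Eucl d → ℝ} {G : Eucl d → Eucl d}
    (hu : HasGlobalWeakGradient u G) {χ : Eucl d → ℝ}
    (hχ : ContDiff ℝ ((⊤ : ℕ∞) : WithTop ℕ∞) χ) (hχc : HasCompactSupport χ) :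
    HasGlobalWeakGradient (fun x => χ x * u x) (fun x => χ x • G x + u x • gradient χ x) := by
  obtain ⟨B, hB⟩ := hχc.exists_bound_of_continuous hχ.continuous
  obtain ⟨L, hL⟩ := exists_norm_gradient_le hχ hχc
  have i1 : Integrable (fun x => χ x * u x) :=
    hu.integrable.bdd_mul hχ.continuous.aestronglyMeasurable (Eventually.of_forall hB)
  have i2 : Integrable (fun x => χ x • G x) :=
    hu.integrable_grad.bdd_smul B hχ.continuous.aestronglyMeasurable (Eventually.of_forall hB)
  have i3 : Integrable (fun x => u x • gradient χ x) :=
    hu.integrable.smul_bdd (L : ℝ) (continuous_gradient_of_contDiff hχ).aestronglyMeasurable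
      (Eventually.of_forall hL)
  refine ⟨i1, i2.add i3, fun ζ hζ hζc z => ?_⟩
  have h := hu.integral_eq (fun x => χ x * ζ x) (hχ.mul hζ) hζc.mul_left z
  have hfd : ∀ x, fderiv ℝ (fun x => χ x * ζ x) x z =
      χ x * fderiv ℝ ζ x z + ζ x * inner ℝ (gradient χ x) z := by
    intro x
    rw [fderiv_fun_mul (hχ.differentiable (by simp) x) (hζ.differentiable (by simp) x),
      inner_gradient_eq_fderiv (hχ.differentiable (by simp) x)]
    simp
  obtain ⟨Bζ, hBζ⟩ := hζc.exists_bound_of_continuous hζ.continuous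
  have hζ1 : ContDiff ℝ 1 ζ := hζ.of_le (by exact_mod_cast le_top)
  obtain ⟨D, hD⟩ := (hζc.fderiv_apply (𝕜 := ℝ) z).exists_bound_of_continuous
    ((hζ1.continuous_fderiv one_ne_zero).clm_apply continuous_const)
  have j1 : Integrable (fun x => χ x * u x * fderiv ℝ ζ x z) :=
    i1.mul_bdd ((hζ1.continuous_fderiv one_ne_zero).clm_apply
      continuous_const).aestronglyMeasurable (Eventually.of_forall hD)
  have j2 : Integrable (fun x => ζ x * inner ℝ (u x • gradient χ x) z) :=
    (i3.inner_const z).bdd_mul hζ.continuous.aestronglyMeasurable (Eventually.of_forall hBζ)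
  have j3 : Integrable (fun x => ζ x * inner ℝ (χ x • G x) z) :=
    (i2.inner_const z).bdd_mul hζ.continuous.aestronglyMeasurable (Eventually.of_forall hBζ)
  have e1 : ∫ x, u x * fderiv ℝ (fun x => χ x * ζ x) x z =
      ∫ x, (χ x * u x * fderiv ℝ ζ x z + ζ x * inner ℝ (u x • gradient χ x) z) := by
    refine integral_congr_ae (Eventually.of_forall fun x => ?_)
    simp only [hfd, real_inner_smul_left]
    ring
  have e2 : ∫ x, χ x * ζ x * inner ℝ (G x) z = ∫ x, ζ x * inner ℝ (χ x • G x) z := by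
    refine integral_congr_ae (Eventually.of_forall fun x => ?_)
    simp only [real_inner_smul_left]
    ring
  rw [e1, integral_add j1 j2, e2] at h
  simp_rw [inner_add_left, mul_add]
  rw [integral_add j3 j2]
  linarith

theorem IsAdmissible.modular_const_lt_top (hΦ : IsAdmissible Ω Φ) (hΩ : IsOpen Ω)
    (hΩfin : volume Ω < ∞) (T : ℝ≥0) : ∫⁻ x in Ω, Φ x T < ∞ := by
  obtain ⟨C, hC⟩ := hΦ.bounded T
  calc ∫⁻ x in Ω, Φ x T ≤ ∫⁻ _ in Ω, (C : ℝ≥0∞) := setLIntegral_mono' hΩ.measurableSet hC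
    _ = C * volume Ω := setLIntegral_const _ _
    _ < ∞ := ENNReal.mul_lt_top ENNReal.coe_lt_top hΩfin

theorem IsAdmissible.modular_lt_top_of_norm_le (hΦ : IsAdmissible Ω Φ) (hΩ : IsOpen Ω)
    (hΩfin : volume Ω < ∞) {G H : Eucl d → Eucl d} (hmod : modular Ω Φ G < ∞)
    {T : ℝ≥0} (hH : ∀ x, ‖H x‖ ≤ ‖G x‖ + T) : modular Ω Φ H < ∞ := by
  obtain ⟨c, -, hc⟩ := hΦ.exists_add_le
  have hle : modular Ω Φ H ≤ ∫⁻ x in Ω, c * (Φ x ‖G x‖₊ + Φ x T) :=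
    setLIntegral_mono' hΩ.measurableSet fun x hx =>
      (hΦ.monotone hx (show ‖H x‖₊ ≤ ‖G x‖₊ + T from hH x)).trans (hc x hx _ _)
  refine hle.trans_lt ?_
  rw [lintegral_const_mul' _ _ ENNReal.coe_ne_top,
    lintegral_add_right' _ (hΦ.aemeasurable _ aemeasurable_const)]
  exact ENNReal.mul_lt_top ENNReal.coe_lt_top
    (ENNReal.add_lt_top.2 ⟨hmod, hΦ.modular_const_lt_top hΩ hΩfin T⟩)

open scoped Manifold ContDiff in
/-- Finite smooth partitions of unity on a compact subset of `ℝ^d`. -/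
theorem exists_finite_partition {K : Set (Eucl d)} (hK : IsCompact K) {r : Eucl d → ℝ}
    (hr : ∀ x ∈ K, 0 < r x) :
    ∃ (t : Finset (Eucl d)) (χ : t → Eucl d → ℝ), (∀ i : t, (i : Eucl d) ∈ K) ∧
      (∀ i, ContDiff ℝ ((⊤ : ℕ∞) : WithTop ℕ∞) (χ i)) ∧ (∀ i, HasCompactSupport (χ i)) ∧
      (∀ i x, 0 ≤ χ i x ∧ χ i x ≤ 1) ∧ (∀ i x, x ∈ tsupport (χ i) → dist x i ≤ r i) ∧
      ∀ x ∈ K, ∑ i, χ i x = 1 := by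
  obtain ⟨t, htK, ht⟩ := hK.elim_nhds_subcover (fun x => Metric.ball x (r x))
    fun x hx => Metric.ball_mem_nhds x (hr x hx)
  obtain ⟨f, hf⟩ := SmoothPartitionOfUnity.exists_isSubordinate 𝓘(ℝ, Eucl d) hK.isClosed
    (fun i : t => Metric.ball (i : Eucl d) (r i)) (fun i => Metric.isOpen_ball) (by
      intro x hx
      obtain ⟨i, hi, hxi⟩ := Set.mem_iUnion₂.1 (ht hx)
      exact Set.mem_iUnion.2 ⟨⟨i, hi⟩, hxi⟩)
  have hsub : ∀ (i : t) x, x ∈ tsupport (f i) → dist x i ≤ r i := fun i x hx =>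
    (Metric.mem_ball.1 (hf i hx)).le
  refine ⟨t, fun i => f i, fun i => htK i i.2, fun i => (f i).contMDiff.contDiff, fun i => ?_,
    fun i x => ⟨f.nonneg i x, f.le_one i x⟩, hsub, fun x hx => ?_⟩
  · exact (isCompact_closedBall (i : Eucl d) (r i)).of_isClosed_subset (isClosed_tsupport _)
      (hsub i)
  · rw [← finsum_eq_sum_of_fintype]
    exact f.sum_eq_one hx

/-- Bounded functions with bounded support are approximable. -/
theorem Approximable.of_bounded_of_support (hΦ : IsAdmissible Ω Φ) (hΩ : IsOpen Ω)
    (hΩL : HasLipschitzBoundary Ω) (hΩfin : volume Ω < ∞) {u : Eucl d → ℝ} {G : Eucl d → Eucl d}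
    (hu : HasGlobalWeakGradient u G) (hmod : modular Ω Φ G < ∞) {b : ℝ≥0} (hb : ∀ x, ‖u x‖ ≤ b)
    {R : ℝ} (hu0 : ∀ x, ¬ (x ∈ Ω ∧ ‖x‖ ≤ R) → u x = 0)
    (hG0 : ∀ x, ¬ (x ∈ Ω ∧ ‖x‖ ≤ R) → G x = 0) : Approximable Ω Φ u G := by
  -- The margin `1` in the radius makes the partition sum to one in a whole neighbourhood of each `x
  -- ∈ Ω` with `‖x‖ ≤ R`, so that the gradients of its members add up to zero there.
  set K := closure Ω ∩ Metric.closedBall (0 : Eucl d) (R + 1) with hK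
  have hKc : IsCompact K := (isCompact_closedBall _ _).inter_left isClosed_closure
  have hex : ∀ x₀ : Eucl d, ∃ r : ℝ, x₀ ∈ K → 0 < r ∧ ∃ e : Eucl d, ‖e‖ ≤ 1 ∧ ∃ c : ℝ, 0 < c ∧
      c ≤ 1 ∧ ∀ δ : ℝ, 0 < δ → δ ≤ r → ∀ y ∈ closure Ω, dist y x₀ ≤ r → ∀ z,
        ‖z - δ • e‖ ≤ c * δ → y + z ∈ Ω := by
    intro x₀
    by_cases hx₀ : x₀ ∈ K
    · obtain ⟨e, he, c, hc, hc1, r, hr, h⟩ := hΩL.exists_translate_mem hΩ hx₀.1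
      exact ⟨r, fun _ => ⟨hr, e, he, c, hc, hc1, h⟩⟩
    · exact ⟨0, fun h => (hx₀ h).elim⟩
  choose r hr using hex
  obtain ⟨t, χ, htK, hχ, hχc, hχ01, hχs, hχ1⟩ :=
    exists_finite_partition hKc fun x hx => (hr x hx).1
  have hsum : ∀ i, HasGlobalWeakGradient (fun x => χ i x * u x)
      (fun x => χ i x • G x + u x • gradient (χ i) x) := fun i => hu.mul (hχ i) (hχc i)
  have happ : ∀ i, Approximable Ω Φ (fun x => χ i x * u x)
      (fun x => χ i x • G x + u x • gradient (χ i) x) := by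
    intro i
    obtain ⟨hr0, e, he, c, hc, hc1, h⟩ := hr i (htK i)
    obtain ⟨L, hL⟩ := exists_norm_gradient_le (hχ i) (hχc i)
    refine Approximable.of_translate_mem hΦ hΩ hΩfin (hsum i) ?_ he hc hc1 hr0 h ?_ ?_
    · refine hΦ.modular_lt_top_of_norm_le hΩ hΩfin hmod (T := b * L) fun x => ?_
      refine (norm_add_le _ _).trans ?_
      rw [norm_smul, norm_smul, Real.norm_of_nonneg (hχ01 i x).1]
      push_cast
      gcongr
      · exact mul_le_of_le_one_left (norm_nonneg _) (hχ01 i x).2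
      · exact hb x
      · exact hL x
    · intro x hx
      by_cases hxΩ : x ∈ Ω
      · have : χ i x = 0 := image_eq_zero_of_notMem_tsupport fun hmem =>
          hx ⟨hxΩ, hχs i x hmem⟩
        simp [this]
      · simp [hu0 x fun h => hxΩ h.1]
    · intro x hx
      simp [hu0 x fun h => hx h.1, hG0 x fun h => hx h.1]
  have hfinal := Approximable.sum hΦ hΩ Finset.univ (fun i => (hsum i).integrable)
    (fun i => (hsum i).integrable_grad) happ
  have hone : ∀ x, x ∈ Ω → ‖x‖ ≤ R → ∀ᶠ y in 𝓝 x, ∑ i, χ i y = 1 := by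
    intro x hx hxR
    have h1 : ∀ᶠ y in 𝓝 x, y ∈ Metric.ball (0 : Eucl d) (R + 1) :=
      Metric.isOpen_ball.mem_nhds (by rw [mem_ball_zero_iff]; linarith)
    filter_upwards [hΩ.mem_nhds hx, h1] with y hy hyR
    exact hχ1 y ⟨subset_closure hy, Metric.ball_subset_closedBall hyR⟩
  refine hfinal.congr hΩ (fun x hx => ?_) fun x hx => ?_
  · by_cases hxR : ‖x‖ ≤ R
    · rw [← Finset.sum_mul, (hone x hx hxR).self_of_nhds, one_mul]
    · simp [hu0 x fun h => hxR h.2]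
  · by_cases hxR : ‖x‖ ≤ R
    · have hg : ∑ i, gradient (χ i) x = 0 := by
        rw [← gradient_sum _ fun i _ => (hχ i).differentiable (by simp) x]
        have h2 : fderiv ℝ (fun y => ∑ i, χ i y) x = 0 := by
          rw [Filter.EventuallyEq.fderiv_eq (f := fun _ => (1 : ℝ)) (hone x hx hxR)]
          simp
        rw [gradient, h2, map_zero]
      rw [Finset.sum_add_distrib, ← Finset.sum_smul, ← Finset.smul_sum, hg,
        (hone x hx hxR).self_of_nhds]
      simp
    · simp [hu0 x fun h => hxR h.2, hG0 x fun h => hxR h.2]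

/-- Dominated convergence for the modular. -/
theorem IsAdmissible.tendsto_modular_zero (hΦ : IsAdmissible Ω Φ) (hΩ : IsOpen Ω)
    (hΩfin : volume Ω < ∞) {G : Eucl d → Eucl d} (hmod : modular Ω Φ G < ∞)
    {H : ℕ → Eucl d → Eucl d} (hH : ∀ n, AEStronglyMeasurable (H n) (volume.restrict Ω)) {T : ℝ≥0}
    (hle : ∀ n x, ‖H n x‖ ≤ 2 * ‖G x‖ + T) (hlim : ∀ x, Tendsto (fun n => H n x) atTop (𝓝 0)) :
    Tendsto (fun n => modular Ω Φ (H n)) atTop (𝓝 0) := by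
  obtain ⟨c, -, hc⟩ := hΦ.exists_add_le
  obtain ⟨c₂, -, hc₂⟩ := hΦ.exists_mul_le 2
  have h := tendsto_lintegral_of_dominated_convergence' (μ := volume.restrict Ω)
    (F := fun n x => Φ x ‖H n x‖₊) (f := fun _ => 0)
    (fun x => c * (c₂ * Φ x ‖G x‖₊ + Φ x T))
    (fun n => hΦ.aemeasurable _ (hH n).nnnorm.aemeasurable) ?_ ?_ ?_
  · simpa [modular] using h
  · intro n
    filter_upwards [ae_restrict_mem hΩ.measurableSet] with x hx
    calc Φ x ‖H n x‖₊ ≤ Φ x (2 * ‖G x‖₊ + T) :=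
          hΦ.monotone hx (show (‖H n x‖₊ : ℝ) ≤ _ by simpa using hle n x)
      _ ≤ c * (Φ x (2 * ‖G x‖₊) + Φ x T) := hc x hx _ _
      _ ≤ c * (c₂ * Φ x ‖G x‖₊ + Φ x T) := by
          gcongr
          exact hc₂ x hx _
  · rw [lintegral_const_mul' _ _ ENNReal.coe_ne_top,
      lintegral_add_right' _ (hΦ.aemeasurable _ aemeasurable_const),
      lintegral_const_mul' _ _ ENNReal.coe_ne_top]
    have h1 := (hΦ.modular_const_lt_top hΩ hΩfin T).ne
    have h2 : ∫⁻ x in Ω, Φ x ‖G x‖₊ ≠ ∞ := hmod.ne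
    finiteness
  · filter_upwards [ae_restrict_mem hΩ.measurableSet] with x hx
    refine (hΦ.tendsto_zero x hx).comp ?_
    simpa using (hlim x).nnnorm

theorem tendsto_lintegral_enorm_of_dominated {F : Type*} [NormedAddCommGroup F]
    {μ : Measure (Eucl d)} {f : ℕ → Eucl d → F} {g : Eucl d → ℝ}
    (hf : ∀ n, AEStronglyMeasurable (f n) μ) (hg : Integrable g μ) (hle : ∀ n x, ‖f n x‖ ≤ g x)
    (hlim : ∀ᵐ x ∂μ, Tendsto (fun n => f n x) atTop (𝓝 0)) :
    Tendsto (fun n => ∫⁻ x, ‖f n x‖ₑ ∂μ) atTop (𝓝 0) := by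
  have h := tendsto_lintegral_of_dominated_convergence' (F := fun n x => ‖f n x‖ₑ)
    (f := fun _ => 0) (μ := μ) (fun x => ‖g x‖ₑ) (fun n => (hf n).enorm) ?_ ?_ ?_
  · simpa using h
  · intro n
    filter_upwards with x
    rw [← ofReal_norm, ← ofReal_norm]
    exact ENNReal.ofReal_le_ofReal ((hle n x).trans (Real.le_norm_self _))
  · exact hg.2.ne
  · filter_upwards [hlim] with x hx
    simpa using hx.enorm

/-- Bounded functions are approximable. -/
theorem Approximable.of_bounded (hΦ : IsAdmissible Ω Φ) (hΩ : IsOpen Ω)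
    (hΩL : HasLipschitzBoundary Ω) (hΩfin : volume Ω < ∞) {u : Eucl d → ℝ} {G : Eucl d → Eucl d}
    (hu : HasGlobalWeakGradient u G) (hmod : modular Ω Φ G < ∞) {b : ℝ≥0} (hb : ∀ x, ‖u x‖ ≤ b)
    (hu0 : ∀ x ∉ Ω, u x = 0) (hG0 : ∀ x ∉ Ω, G x = 0) : Approximable Ω Φ u G := by
  let f : ContDiffBump (0 : Eucl d) := ⟨1, 2, one_pos, one_lt_two⟩
  have hf : ContDiff ℝ ((⊤ : ℕ∞) : WithTop ℕ∞) f := f.contDiff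
  obtain ⟨L, hL⟩ := exists_norm_gradient_le hf f.hasCompactSupport
  let s : ℕ → ℝ := fun n => 1 / ((n : ℝ) + 1)
  have hs0 : ∀ n, 0 < s n := fun n => Nat.one_div_pos_of_nat
  have hs1 : ∀ n, s n ≤ 1 := fun n => by
    rw [div_le_one (by positivity)]
    linarith [(Nat.cast_nonneg n : (0 : ℝ) ≤ n)]
  have hslim : Tendsto s atTop (𝓝 0) := tendsto_one_div_add_atTop_nhds_zero_nat
  -- Dilated cutoffs: `χ n` is supported in the ball of radius `2 * (n + 1)` and its gradient is of
  -- order `1 / (n + 1)`.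
  let χ : ℕ → Eucl d → ℝ := fun n x => f (s n • x)
  have hχ : ∀ n, ContDiff ℝ ((⊤ : ℕ∞) : WithTop ℕ∞) (χ n) := fun n =>
    hf.comp (contDiff_const_smul (s n))
  have hχc : ∀ n, HasCompactSupport (χ n) := fun n =>
    f.hasCompactSupport.comp_smul (hs0 n).ne'
  have hgrad : ∀ n x, gradient (χ n) x = s n • gradient f (s n • x) := fun n x =>
    gradient_comp_smul (hf.differentiable (by simp)) (s n) x
  have hgradle : ∀ n x, ‖gradient (χ n) x‖ ≤ s n * L := by
    intro n x
    rw [hgrad, norm_smul, Real.norm_of_nonneg (hs0 n).le]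
    have := hs0 n
    gcongr
    exact hL _
  have hχ1 : ∀ x, ∀ᶠ n in atTop, χ n x = 1 := by
    intro x
    have h1 : Tendsto (fun n => s n • x) atTop (𝓝 0) := by simpa using hslim.smul_const x
    filter_upwards [h1.eventually (Metric.closedBall_mem_nhds (0 : Eucl d) one_pos)] with n hn
    exact f.one_of_mem_closedBall hn
  have hχlim : ∀ x, Tendsto (fun n => χ n x) atTop (𝓝 1) := fun x =>
    tendsto_const_nhds.congr' (by filter_upwards [hχ1 x] with n hn using hn.symm)
  have hχ01 : ∀ n x, ‖χ n x‖ ≤ 1 := fun n x => by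
    rw [Real.norm_of_nonneg f.nonneg]
    exact f.le_one
  have hχ01' : ∀ n x, ‖χ n x - 1‖ ≤ 1 := fun n x => by
    have h1 : 0 ≤ χ n x := f.nonneg
    have h2 : χ n x ≤ 1 := f.le_one
    rw [Real.norm_eq_abs, abs_le]
    constructor <;> linarith
  have hgb : ∀ n x, ‖u x • gradient (χ n) x‖ ≤ s n * (b * L) := by
    intro n x
    rw [norm_smul]
    have := hs0 n
    calc ‖u x‖ * ‖gradient (χ n) x‖ ≤ b * (s n * L) := by
          gcongr
          · exact hb x
          · exact hgradle n x
      _ = s n * (b * L) := by ring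
  have hgb1 : ∀ n x, ‖u x • gradient (χ n) x‖ ≤ (b * L : ℝ≥0) := fun n x => by
    refine (hgb n x).trans ?_
    push_cast
    exact mul_le_of_le_one_left (by positivity) (hs1 n)
  have hgbu : ∀ n x, ‖u x • gradient (χ n) x‖ ≤ ‖u x‖ * L := fun n x => by
    rw [norm_smul]
    gcongr
    exact (hgradle n x).trans (mul_le_of_le_one_left L.2 (hs1 n))
  have hw := fun n => hu.mul (hχ n) (hχc n)
  have heq : ∀ n x, χ n x • G x + u x • gradient (χ n) x - G x =
      (χ n x - 1) • G x + u x • gradient (χ n) x := fun n x => by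
    rw [sub_smul, one_smul]
    abel
  have hlim : ∀ x, Tendsto (fun n => (χ n x - 1) • G x + u x • gradient (χ n) x) atTop (𝓝 0) := by
    intro x
    have h1 : Tendsto (fun n => (χ n x - 1) • G x) atTop (𝓝 0) := by
      simpa using ((hχlim x).sub_const 1).smul_const (G x)
    have h2 : Tendsto (fun n => u x • gradient (χ n) x) atTop (𝓝 0) :=
      squeeze_zero_norm (fun n => hgb n x) (by simpa using hslim.mul_const (b * L : ℝ))
    simpa using h1.add h2
  have hmeas : ∀ n, AEStronglyMeasurable
      (fun x => (χ n x - 1) • G x + u x • gradient (χ n) x) volume := fun n => by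
    simp_rw [← heq]
    exact (hw n).integrable_grad.1.sub hu.integrable_grad.1
  have hsm : ∀ n x, ‖(χ n x - 1) • G x‖ ≤ ‖G x‖ := fun n x => by
    rw [norm_smul]
    exact mul_le_of_le_one_left (norm_nonneg _) (hχ01' n x)
  refine Approximable.of_limit hΦ hΩ (fun n => (hw n).integrable)
    (fun n => (hw n).integrable_grad) (fun n => ?_) ?_ ?_ ?_
  · refine Approximable.of_bounded_of_support hΦ hΩ hΩL hΩfin (hw n) ?_ (b := b)
      (R := 2 * (n + 1)) (fun x => ?_) (fun x hx => ?_) (fun x hx => ?_)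
    · refine hΦ.modular_lt_top_of_norm_le hΩ hΩfin hmod (T := b * L) fun x => ?_
      refine (norm_add_le _ _).trans (add_le_add ?_ (hgb1 n x))
      rw [norm_smul]
      exact mul_le_of_le_one_left (norm_nonneg _) (hχ01 n x)
    · rw [norm_mul]
      exact (mul_le_of_le_one_left (norm_nonneg _) (hχ01 n x)).trans (hb x)
    all_goals
      by_cases hxΩ : x ∈ Ω
      · have hxn : s n • x ∉ tsupport f := by
          rw [f.tsupport_eq, Metric.mem_closedBall, dist_zero_right, norm_smul,
            Real.norm_of_nonneg (hs0 n).le]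
          change ¬ (1 / ((n : ℝ) + 1) * ‖x‖ ≤ 2)
          rw [one_div, inv_mul_le_iff₀ (by positivity), mul_comm _ (2 : ℝ)]
          exact fun hle => hx ⟨hxΩ, hle⟩
        have h1 : χ n x = 0 := image_eq_zero_of_notMem_tsupport (f := f) hxn
        simp [h1, hgrad, gradient_eq_zero_of_notMem_tsupport hxn]
      · simp [hu0 x hxΩ, hG0 x hxΩ]
  · refine tendsto_lintegral_enorm_of_dominated (g := fun x => ‖u x‖)
      (fun n => ((hw n).integrable.1.sub hu.integrable.1).restrict) hu.integrable.norm.restrict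
      (fun n x => ?_) (Eventually.of_forall fun x => ?_)
    · rw [show χ n x * u x - u x = (χ n x - 1) * u x by ring, norm_mul]
      exact mul_le_of_le_one_left (norm_nonneg _) (hχ01' n x)
    · simpa using ((hχlim x).mul_const (u x)).sub_const (u x)
  · simp_rw [heq]
    refine tendsto_lintegral_enorm_of_dominated (g := fun x => ‖G x‖ + ‖u x‖ * L)
      (fun n => (hmeas n).restrict)
      (hu.integrable_grad.norm.add (hu.integrable.norm.mul_const _)).restrict
      (fun n x => (norm_add_le _ _).trans (add_le_add (hsm n x) (hgbu n x)))
      (Eventually.of_forall hlim)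
  · simp_rw [heq]
    refine hΦ.tendsto_modular_zero hΩ hΩfin hmod
      (fun n => (hmeas n).restrict) (T := b * L) (fun n x => ?_) hlim
    refine (norm_add_le _ _).trans (add_le_add ((hsm n x).trans ?_) (hgb1 n x))
    linarith [norm_nonneg (G x)]

/-! ### Truncation -/

theorem HasGlobalWeakGradient.of_contDiff {v : Eucl d → ℝ}
    (hv : ContDiff ℝ ((⊤ : ℕ∞) : WithTop ℕ∞) v) (hvc : HasCompactSupport v) :
    HasGlobalWeakGradient v (gradient v) := by
  refine ⟨hv.continuous.integrable_of_hasCompactSupport hvc,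
    (continuous_gradient_of_contDiff hv).integrable_of_hasCompactSupport
      (hasCompactSupport_gradient hvc), fun ζ hζ hζc z => ?_⟩
  have hcont : ∀ {f : Eucl d → ℝ}, ContDiff ℝ ((⊤ : ℕ∞) : WithTop ℕ∞) f →
      Continuous fun x => fderiv ℝ f x z := fun hf =>
    (hf.continuous_fderiv (by simp)).clm_apply continuous_const
  rw [integral_mul_fderiv_eq_neg_fderiv_mul_of_integrable]
  · congr 1
    refine integral_congr_ae (Eventually.of_forall fun x => ?_)
    simp only [inner_gradient_eq_fderiv (hv.differentiable (by simp) x), mul_comm]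
  · exact ((hcont hv).mul hζ.continuous).integrable_of_hasCompactSupport hζc.mul_left
  · exact (hv.continuous.mul (hcont hζ)).integrable_of_hasCompactSupport hvc.mul_right
  · exact (hv.continuous.mul hζ.continuous).integrable_of_hasCompactSupport hζc.mul_left
  · exact fun x _ => hv.differentiable (by simp) x
  · exact fun x _ => hζ.differentiable (by simp) x

/-- For fixed `ζ` both sides of the integration by parts formula are continuous in `L¹`. -/
theorem HasGlobalWeakGradient.of_limit {u : Eucl d → ℝ} {G : Eucl d → Eucl d}
    (hu : Integrable u) (hG : Integrable G) {w : ℕ → Eucl d → ℝ} {H : ℕ → Eucl d → Eucl d}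
    (hw : ∀ n, HasGlobalWeakGradient (w n) (H n))
    (h1 : Tendsto (fun n => ∫⁻ x, ‖w n x - u x‖ₑ) atTop (𝓝 0))
    (h2 : Tendsto (fun n => ∫⁻ x, ‖H n x - G x‖ₑ) atTop (𝓝 0)) : HasGlobalWeakGradient u G := by
  refine ⟨hu, hG, fun ζ hζ hζc z => ?_⟩
  obtain ⟨B, hB⟩ := hζc.exists_bound_of_continuous hζ.continuous
  have hcont : Continuous fun x => fderiv ℝ ζ x z :=
    (hζ.continuous_fderiv (by simp)).clm_apply continuous_const
  obtain ⟨D, hD⟩ := (hζc.fderiv_apply (𝕜 := ℝ) z).exists_bound_of_continuous hcont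
  have i1 : ∀ {f : Eucl d → ℝ}, Integrable f → Integrable (fun x => f x * fderiv ℝ ζ x z) :=
    fun hf => hf.mul_bdd hcont.aestronglyMeasurable (Eventually.of_forall hD)
  have i2 : ∀ {F : Eucl d → Eucl d}, Integrable F → Integrable (fun x => ζ x * inner ℝ (F x) z) :=
    fun hF => (hF.inner_const z).bdd_mul hζ.continuous.aestronglyMeasurable
      (Eventually.of_forall hB)
  have t1 : Tendsto (fun n => ∫ x, w n x * fderiv ℝ ζ x z) atTop
      (𝓝 (∫ x, u x * fderiv ℝ ζ x z)) := by
    refine tendsto_integral_of_L1 _ (i1 hu).1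
      (Eventually.of_forall fun n => i1 (hw n).integrable) ?_
    have h := ENNReal.Tendsto.const_mul h1 (Or.inr ENNReal.ofReal_ne_top) (a := ENNReal.ofReal D)
    rw [mul_zero] at h
    refine tendsto_of_tendsto_of_tendsto_of_le_of_le tendsto_const_nhds h (fun _ => zero_le)
      fun n => ?_
    simp only
    rw [← lintegral_const_mul' _ _ ENNReal.ofReal_ne_top]
    refine lintegral_mono fun x => ?_
    rw [← sub_mul, enorm_mul, mul_comm]
    gcongr
    rw [← ofReal_norm]
    exact ENNReal.ofReal_le_ofReal (hD x)
  have t2 : Tendsto (fun n => ∫ x, ζ x * inner ℝ (H n x) z) atTop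
      (𝓝 (∫ x, ζ x * inner ℝ (G x) z)) := by
    refine tendsto_integral_of_L1 _ (i2 hG).1
      (Eventually.of_forall fun n => i2 (hw n).integrable_grad) ?_
    have h := ENNReal.Tendsto.const_mul h2 (Or.inr ENNReal.ofReal_ne_top)
      (a := ENNReal.ofReal (B * ‖z‖))
    rw [mul_zero] at h
    refine tendsto_of_tendsto_of_tendsto_of_le_of_le tendsto_const_nhds h (fun _ => zero_le)
      fun n => ?_
    simp only
    rw [← lintegral_const_mul' _ _ ENNReal.ofReal_ne_top]
    refine lintegral_mono fun x => ?_
    have hB0 : 0 ≤ B := (norm_nonneg _).trans (hB x)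
    rw [← mul_sub, ← inner_sub_left, ← ofReal_norm, ← ofReal_norm,
      ← ENNReal.ofReal_mul (by positivity)]
    refine ENNReal.ofReal_le_ofReal ?_
    rw [norm_mul]
    calc ‖ζ x‖ * ‖inner ℝ (H n x - G x) z‖ ≤ B * (‖H n x - G x‖ * ‖z‖) := by
          gcongr
          · exact hB x
          · exact norm_inner_le_norm _ _
      _ = B * ‖z‖ * ‖H n x - G x‖ := by ring
  have hn : ∀ n, ∫ x, w n x * fderiv ℝ ζ x z = -∫ x, ζ x * inner ℝ (H n x) z := fun n =>
    (hw n).integral_eq ζ hζ hζc z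
  simp_rw [hn] at t1
  exact tendsto_nhds_unique t1 t2.neg

theorem norm_mul_sin_div_sub_le {l : ℝ} (hl : 0 < l) (s t : ℝ) :
    ‖l * Real.sin (s / l) - l * Real.sin (t / l)‖ ≤ ‖s - t‖ := by
  rw [← mul_sub, norm_mul, Real.norm_of_nonneg hl.le]
  have h : ‖Real.sin (s / l) - Real.sin (t / l)‖ ≤ ‖s / l - t / l‖ := by
    have := Real.abs_sin_sub_sin_le (s / l) (t / l)
    simpa using this
  calc l * ‖Real.sin (s / l) - Real.sin (t / l)‖ ≤ l * ‖s / l - t / l‖ := by gcongr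
    _ = ‖s - t‖ := by
      rw [← sub_div, norm_div, Real.norm_of_nonneg hl.le]
      field_simp

theorem norm_mul_sin_div_le {l : ℝ} (hl : 0 < l) (s : ℝ) : ‖l * Real.sin (s / l)‖ ≤ ‖s‖ := by
  simpa using norm_mul_sin_div_sub_le hl s 0

/-- The chain rule for the bounded truncation `s ↦ l sin (s / l)`. -/
theorem HasGlobalWeakGradient.mul_sin_div {u : Eucl d → ℝ} {G : Eucl d → Eucl d}
    (hu : Integrable u) (hG : Integrable G) {v : ℕ → Eucl d → ℝ}
    (hv : ∀ n, ContDiff ℝ ((⊤ : ℕ∞) : WithTop ℕ∞) (v n)) (hvc : ∀ n, HasCompactSupport (v n))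
    (h1 : Tendsto (fun n => ∫⁻ x, ‖v n x - u x‖ₑ) atTop (𝓝 0))
    (h2 : Tendsto (fun n => ∫⁻ x, ‖gradient (v n) x - G x‖ₑ) atTop (𝓝 0)) {l : ℝ} (hl : 0 < l) :
    HasGlobalWeakGradient (fun x => l * Real.sin (u x / l))
      (fun x => Real.cos (u x / l) • G x) := by
  have hvm : ∀ n, AEStronglyMeasurable (v n) volume := fun n =>
    (hv n).continuous.aestronglyMeasurable
  have h1' : Tendsto (fun n => eLpNorm (v n - u) 1 volume) atTop (𝓝 0) := by
    simpa [eLpNorm_one_eq_lintegral_enorm] using h1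
  -- A subsequence converging a.e. is needed for `cos (v n / l)`, which multiplies the merely
  -- integrable `G`; dominated convergence applies along it.
  obtain ⟨ns, hns, hae⟩ := (tendstoInMeasure_of_tendsto_eLpNorm one_ne_zero
    hvm hu.1 h1').exists_seq_tendsto_ae
  have hcosm : ∀ {f : Eucl d → ℝ}, AEStronglyMeasurable f volume →
      AEStronglyMeasurable (fun x => Real.cos (f x / l)) volume := fun hf =>
    (Real.continuous_cos.comp (continuous_id.div_const l)).comp_aestronglyMeasurable hf
  have hsinm : AEStronglyMeasurable (fun x => l * Real.sin (u x / l)) volume :=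
    (continuous_const.mul (Real.continuous_sin.comp
      (continuous_id.div_const l))).comp_aestronglyMeasurable hu.1
  have hcos1 : ∀ s, ‖Real.cos s‖ ≤ 1 := fun s => Real.abs_cos_le_one s
  have hi1 : Integrable (fun x => l * Real.sin (u x / l)) :=
    hu.mono hsinm (Eventually.of_forall fun x => norm_mul_sin_div_le hl _)
  have hi2 : Integrable (fun x => Real.cos (u x / l) • G x) :=
    hG.bdd_smul 1 (hcosm hu.1) (Eventually.of_forall fun x => hcos1 _)
  have hgrad : ∀ n x, gradient (fun y => l * Real.sin (v n y / l)) x =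
      Real.cos (v n x / l) • gradient (v n) x := by
    intro n x
    refine gradient_real_comp (T := fun s => l * Real.sin (s / l))
      ((hv n).differentiable (by simp) x) ?_
    have h := (((hasDerivAt_id (v n x)).div_const l).sin).const_mul l
    convert! h using 1
    simp only [id]
    field_simp
  have hsmooth : ∀ n, HasGlobalWeakGradient (fun x => l * Real.sin (v n x / l))
      (fun x => Real.cos (v n x / l) • gradient (v n) x) := by
    intro n
    have h := HasGlobalWeakGradient.of_contDiff (v := fun x => l * Real.sin (v n x / l))
      (contDiff_const.mul (Real.contDiff_sin.comp ((hv n).div_const l)))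
      ((hvc n).comp_left (g := fun s => l * Real.sin (s / l)) (by simp))
    rwa [show gradient (fun x => l * Real.sin (v n x / l)) = _ from funext (hgrad n)] at h
  refine HasGlobalWeakGradient.of_limit hi1 hi2 (fun n => hsmooth (ns n)) ?_ ?_
  · refine tendsto_of_tendsto_of_tendsto_of_le_of_le tendsto_const_nhds
      (h1.comp hns.tendsto_atTop) (fun _ => zero_le) fun n => lintegral_mono fun x => ?_
    simp only
    rw [← ofReal_norm, ← ofReal_norm]
    exact ENNReal.ofReal_le_ofReal (norm_mul_sin_div_sub_le hl _ _)
  · have t : Tendsto (fun n => ∫⁻ x, ‖(Real.cos (v (ns n) x / l) - Real.cos (u x / l)) • G x‖ₑ)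
        atTop (𝓝 0) := by
      refine tendsto_lintegral_enorm_of_dominated (g := fun x => 2 * ‖G x‖)
        (fun n => ((hcosm (hvm _)).sub (hcosm hu.1)).smul hG.1) (hG.norm.const_mul 2)
        (fun n x => ?_) ?_
      · rw [norm_smul]
        gcongr
        exact (norm_sub_le _ _).trans (by linarith [hcos1 (v (ns n) x / l), hcos1 (u x / l)])
      · filter_upwards [hae] with x hx
        have h3 : Tendsto (fun n => Real.cos (v (ns n) x / l)) atTop (𝓝 (Real.cos (u x / l))) :=
          (Real.continuous_cos.tendsto _).comp (hx.div_const l)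
        simpa using (h3.sub_const (Real.cos (u x / l))).smul_const (G x)
    have t2 := (h2.comp hns.tendsto_atTop).add t
    rw [add_zero] at t2
    refine tendsto_of_tendsto_of_tendsto_of_le_of_le tendsto_const_nhds t2 (fun _ => zero_le)
      fun n => ?_
    simp only [Function.comp_apply]
    have hm : AEMeasurable (fun x => ‖(Real.cos (v (ns n) x / l) - Real.cos (u x / l)) • G x‖ₑ)
        volume := (((hcosm (hvm _)).sub (hcosm hu.1)).smul hG.1).enorm
    rw [← lintegral_add_right' _ hm]
    refine lintegral_mono fun x => ?_
    have : Real.cos (v (ns n) x / l) • gradient (v (ns n)) x - Real.cos (u x / l) • G x =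
        Real.cos (v (ns n) x / l) • (gradient (v (ns n)) x - G x) +
          (Real.cos (v (ns n) x / l) - Real.cos (u x / l)) • G x := by
      rw [smul_sub, sub_smul]
      abel
    simp only
    rw [this]
    refine (enorm_add_le _ _).trans ?_
    gcongr
    rw [← ofReal_norm, ← ofReal_norm]
    refine ENNReal.ofReal_le_ofReal ?_
    rw [norm_smul]
    exact mul_le_of_le_one_left (norm_nonneg _) (hcos1 _)

/-- This is the difference quotient of `x ↦ sin (s * x)` at `0` with increment `1 / (n + 1)`. -/
theorem tendsto_mul_sin_div (s : ℝ) :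
    Tendsto (fun n : ℕ => ((n : ℝ) + 1) * Real.sin (s / (n + 1))) atTop (𝓝 s) := by
  have hd : HasDerivAt (fun x => Real.sin (s * x)) s 0 := by
    simpa using ((hasDerivAt_id (0 : ℝ)).const_mul s).sin
  have h := hd.tendsto_slope_zero
  have h0 : Tendsto (fun n : ℕ => 1 / ((n : ℝ) + 1)) atTop (𝓝[≠] 0) :=
    tendsto_nhdsWithin_iff.2 ⟨tendsto_one_div_add_atTop_nhds_zero_nat,
      Eventually.of_forall fun n => (Nat.one_div_pos_of_nat (n := n)).ne'⟩
  refine (h.comp h0).congr fun n => ?_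
  simp [div_eq_mul_inv]

/-- Functions in `W₀^{1,1}(Ω)` with finite energy are approximable. -/
theorem Approximable.of_memW11Zero (hΦ : IsAdmissible Ω Φ) (hΩ : IsOpen Ω)
    (hΩL : HasLipschitzBoundary Ω) (hΩfin : volume Ω < ∞) {u : Eucl d → ℝ} {G : Eucl d → Eucl d}
    (hu : MemW11Zero Ω u G) (hmod : modular Ω Φ G < ∞) : Approximable Ω Φ u G := by
  obtain ⟨⟨-, hui, hGi⟩, v, hv, hv1, hv2⟩ := hu
  -- Extension by zero stays an `L¹` limit of the same test functions together with their gradients;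
  -- this is where zero boundary values enter.
  set u' := Ω.indicator u with hu'
  set G' := Ω.indicator G with hG'
  have hui' : Integrable u' := hui.integrable_indicator hΩ.measurableSet
  have hGi' : Integrable G' := hGi.integrable_indicator hΩ.measurableSet
  have hmod' : modular Ω Φ G' < ∞ := by
    refine lt_of_eq_of_lt ?_ hmod
    exact setLIntegral_congr_fun hΩ.measurableSet fun x hx => by simp [hG', hx]
  have h1 : Tendsto (fun n => ∫⁻ x, ‖v n x - u' x‖ₑ) atTop (𝓝 0) := by
    refine hv1.congr fun n => ?_
    rw [eLpNorm_one_eq_lintegral_enorm, ← lintegral_indicator hΩ.measurableSet]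
    refine lintegral_congr fun x => ?_
    by_cases hx : x ∈ Ω
    · simp [hu', hx]
    · have : v n x = 0 := image_eq_zero_of_notMem_tsupport fun h => hx ((hv n).2.2 h)
      simp [hu', hx, this]
  have h2 : Tendsto (fun n => ∫⁻ x, ‖gradient (v n) x - G' x‖ₑ) atTop (𝓝 0) := by
    refine hv2.congr fun n => ?_
    rw [eLpNorm_one_eq_lintegral_enorm, ← lintegral_indicator hΩ.measurableSet]
    refine lintegral_congr fun x => ?_
    by_cases hx : x ∈ Ω
    · simp [hG', hx]
    · have : gradient (v n) x = 0 :=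
        gradient_eq_zero_of_notMem_tsupport fun h => hx ((hv n).2.2 h)
      simp [hG', hx, this]
  have hl : ∀ n : ℕ, (0 : ℝ) < n + 1 := fun n => by positivity
  have hw := fun n : ℕ => HasGlobalWeakGradient.mul_sin_div hui' hGi' (fun n => (hv n).1)
    (fun n => (hv n).2.1) h1 h2 (hl n)
  have hcos1 : ∀ s, ‖Real.cos s‖ ≤ 1 := fun s => Real.abs_cos_le_one s
  have hcos2 : ∀ s (y : Eucl d), ‖Real.cos s • y - y‖ ≤ 2 * ‖y‖ := fun s y => by
    refine (norm_sub_le _ _).trans ?_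
    rw [norm_smul]
    nlinarith [hcos1 s, norm_nonneg y]
  have hlimG : ∀ x, Tendsto (fun n : ℕ => Real.cos (u' x / (n + 1)) • G' x - G' x) atTop
      (𝓝 0) := by
    intro x
    have h3 : Tendsto (fun n : ℕ => u' x / ((n : ℝ) + 1)) atTop (𝓝 0) := by
      simpa [div_eq_mul_inv] using
        (tendsto_one_div_add_atTop_nhds_zero_nat (𝕜 := ℝ)).const_mul (u' x)
    have h4 := (((Real.continuous_cos.tendsto _).comp h3).smul_const (G' x)).sub_const (G' x)
    simpa using h4
  have happ : Approximable Ω Φ u' G' := by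
    -- The truncations `(n + 1) sin (u' / (n + 1))` are bounded by `n + 1`, and their gradients `cos
    -- (u' / (n + 1)) • G'` are pointwise no larger than `G'`, so no energy is gained.
    refine Approximable.of_limit hΦ hΩ (fun n => (hw n).integrable)
      (fun n => (hw n).integrable_grad) (fun n => ?_) ?_ ?_ ?_
    · refine Approximable.of_bounded hΦ hΩ hΩL hΩfin (hw n) ?_ (b := n + 1) (fun x => ?_)
        (fun x hx => ?_) fun x hx => ?_
      · refine hΦ.modular_lt_top_of_norm_le hΩ hΩfin hmod' (T := 0) fun x => ?_
        rw [norm_smul, NNReal.coe_zero, add_zero]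
        exact mul_le_of_le_one_left (norm_nonneg _) (hcos1 _)
      · rw [norm_mul, Real.norm_of_nonneg (hl n).le]
        push_cast
        exact mul_le_of_le_one_right (hl n).le (Real.abs_sin_le_one _)
      · simp [hu', hx]
      · simp [hG', hx]
    · refine tendsto_lintegral_enorm_of_dominated (g := fun x => 2 * ‖u' x‖)
        (fun n => ((hw n).integrable.1.sub hui'.1).restrict)
        (hui'.norm.const_mul 2).restrict (fun n x => ?_) (Eventually.of_forall fun x => ?_)
      · refine (norm_sub_le _ _).trans ?_
        linarith [norm_mul_sin_div_le (hl n) (u' x)]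
      · simpa using (tendsto_mul_sin_div (u' x)).sub_const (u' x)
    · exact tendsto_lintegral_enorm_of_dominated (g := fun x => 2 * ‖G' x‖)
        (fun n => ((hw n).integrable_grad.1.sub hGi'.1).restrict)
        (hGi'.norm.const_mul 2).restrict (fun n x => hcos2 _ _) (Eventually.of_forall hlimG)
    · exact hΦ.tendsto_modular_zero hΩ hΩfin hmod'
        (fun n => ((hw n).integrable_grad.1.sub hGi'.1).restrict) (T := 0)
        (fun n x => by simpa using hcos2 _ _) hlimG
  exact happ.congr hΩ (fun x hx => by simp [hu', hx]) fun x hx => by simp [hG', hx]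

/-! ### Regularity and density -/

theorem IsAdmissible.continuousAt (hΦ : IsAdmissible Ω Φ) {x : Eucl d} (hx : x ∈ Ω) (t : ℝ≥0) :
    ContinuousAt (Φ x) t :=
  (continuous_of_convexOn (hΦ.convex x hx) (hΦ.map_zero x hx) fun s => by
    obtain ⟨C, hC⟩ := hΦ.bounded s
    exact ((hC x hx).trans_lt ENNReal.coe_lt_top).ne).continuousAt

theorem IsAdmissible.isRegular (hΦ : IsAdmissible Ω Φ) (hΩ : IsOpen Ω)
    (hΩL : HasLipschitzBoundary Ω) (hΩfin : volume Ω < ∞) : IsRegular Ω Φ := by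
  intro u G hu hmod
  have hpos : ∀ n : ℕ, (0 : ℝ≥0∞) < 2⁻¹ ^ n := fun n =>
    ENNReal.pow_pos (ENNReal.inv_pos.2 ENNReal.ofNat_ne_top) n
  choose v hv e1 e2 e3 using fun n : ℕ =>
    Approximable.of_memW11Zero hΦ hΩ hΩL hΩfin hu.1 hmod (2⁻¹ ^ n) (hpos n)
  have hGm : AEStronglyMeasurable G (volume.restrict Ω) := hu.1.1.2.2.1
  have hgm : ∀ n, AEStronglyMeasurable (gradient (v n)) (volume.restrict Ω) := fun n =>
    (continuous_gradient_of_contDiff (hv n).1).aestronglyMeasurable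
  have hΦm : ∀ n, AEMeasurable (fun x => Φ x ‖gradient (v n) x - G x‖₊) (volume.restrict Ω) :=
    fun n => hΦ.aemeasurable _ ((hgm n).sub hGm).nnnorm.aemeasurable
  refine ⟨v, hv, ⟨?_, ?_⟩, ?_⟩
  · simp_rw [eLpNorm_one_eq_lintegral_enorm]
    exact tendsto_of_tendsto_of_tendsto_of_le_of_le tendsto_const_nhds tendsto_inv_two_pow
      (fun n => zero_le) e1
  · simp_rw [eLpNorm_one_eq_lintegral_enorm]
    exact tendsto_of_tendsto_of_tendsto_of_le_of_le tendsto_const_nhds tendsto_inv_two_pow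
      (fun n => zero_le) e2
  obtain ⟨c, -, hc⟩ := hΦ.exists_add_le
  -- The modulars of the differences are at most `2⁻¹ ^ n`, so their densities sum to an integrable
  -- function; with `Φ x ‖G x‖₊` it dominates every energy density.
  refine tendsto_lintegral_of_dominated_convergence' (μ := volume.restrict Ω)
    (fun x => c * ((∑' n, Φ x ‖gradient (v n) x - G x‖₊) + Φ x ‖G x‖₊))
    (fun n => hΦ.aemeasurable _ (hgm n).nnnorm.aemeasurable) (fun n => ?_) ?_ ?_
  · filter_upwards [ae_restrict_mem hΩ.measurableSet] with x hx
    calc Φ x ‖gradient (v n) x‖₊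
        ≤ Φ x (‖gradient (v n) x - G x‖₊ + ‖G x‖₊) := hΦ.monotone hx (by
          simpa using nnnorm_add_le (gradient (v n) x - G x) (G x))
      _ ≤ c * (Φ x ‖gradient (v n) x - G x‖₊ + Φ x ‖G x‖₊) := hc x hx _ _
      _ ≤ _ := by
          gcongr
          exact ENNReal.le_tsum (f := fun n => Φ x ‖gradient (v n) x - G x‖₊) n
  · have h1 := (lintegral_tsum_lt_top_of_le_geometric hΦm e3).ne
    have h2 : ∫⁻ x in Ω, Φ x ‖G x‖₊ ≠ ∞ := hmod.ne
    rw [lintegral_const_mul' _ _ ENNReal.coe_ne_top,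
      lintegral_add_right' _ (hΦ.aemeasurable _ hGm.nnnorm.aemeasurable)]
    finiteness
  · have hae := ae_tendsto_zero_of_le_geometric (fun n => ((hgm n).sub hGm).enorm) e2
    filter_upwards [ae_restrict_mem hΩ.measurableSet, hae] with x hx hxt
    refine (hΦ.continuousAt hx ‖G x‖₊).tendsto.comp (Tendsto.nnnorm ?_)
    exact tendsto_iff_edist_tendsto_0.2 (by simpa [edist_eq_enorm_sub] using hxt)

/-- Convexity and `Φ x 0 = 0` let a factor `γ⁻¹ ≤ 1` come out of `Φ`, so any `γ ≥ 1` above the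
modular is admissible. -/
theorem luxemburgNorm_lt_top_of_modular_lt_top (hΦ : IsAdmissible Ω Φ) (hΩ : IsOpen Ω)
    {f : Eucl d → Eucl d} (hf : modular Ω Φ f < ∞) : luxemburgNorm Ω Φ f < ∞ := by
  set γ : ℝ≥0 := (modular Ω Φ f).toNNReal + 1 with hγ
  have hγ1 : 1 ≤ γ := le_add_self
  have hγ0 : 0 < γ := zero_lt_one.trans_le hγ1
  have hle : ∫⁻ x in Ω, Φ x (‖f x‖₊ / γ) ≤ 1 := by
    calc ∫⁻ x in Ω, Φ x (‖f x‖₊ / γ) ≤ ∫⁻ x in Ω, (γ⁻¹ : ℝ≥0) * Φ x ‖f x‖₊ := by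
          refine setLIntegral_mono' hΩ.measurableSet fun x hx => ?_
          rw [div_eq_inv_mul]
          exact convexOn_smul_le (hΦ.convex x hx) (hΦ.map_zero x hx) (inv_le_one_of_one_le₀ hγ1) _
      _ = (γ⁻¹ : ℝ≥0) * modular Ω Φ f := lintegral_const_mul' _ _ ENNReal.coe_ne_top
      _ ≤ (γ⁻¹ : ℝ≥0) * γ := by
          gcongr
          rw [hγ, ENNReal.coe_add, ENNReal.coe_toNNReal hf.ne]
          exact le_self_add
      _ = 1 := by
          rw [← ENNReal.coe_mul, inv_mul_cancel₀ hγ0.ne', ENNReal.coe_one]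
  exact (iInf_le_of_le γ (iInf_le_of_le hγ0 (iInf_le _ hle))).trans_lt ENNReal.coe_lt_top

theorem modular_lt_top_of_luxemburgNorm_lt_top (hΦ : IsAdmissible Ω Φ) (hΩ : IsOpen Ω)
    {f : Eucl d → Eucl d} (hf : luxemburgNorm Ω Φ f < ∞) : modular Ω Φ f < ∞ := by
  simp only [luxemburgNorm, iInf_lt_iff] at hf
  obtain ⟨γ, hγ0, hγ, -⟩ := hf
  obtain ⟨c, -, hc⟩ := hΦ.exists_mul_le γ
  calc modular Ω Φ f ≤ ∫⁻ x in Ω, c * Φ x (‖f x‖₊ / γ) := by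
        refine setLIntegral_mono' hΩ.measurableSet fun x hx => ?_
        simpa [mul_div_cancel₀ _ hγ0.ne'] using hc x hx (‖f x‖₊ / γ)
    _ = c * ∫⁻ x in Ω, Φ x (‖f x‖₊ / γ) := lintegral_const_mul' _ _ ENNReal.coe_ne_top
    _ ≤ c * 1 := by gcongr
    _ < ∞ := by simp

/-- By `Δ₂`, dividing the argument by a fixed `γ < η` multiplies the modular by at most a constant
`c`; a modular below `c⁻¹` thus makes `γ` admissible. -/
theorem exists_modular_le_imp_luxemburgNorm_lt (hΦ : IsAdmissible Ω Φ) (hΩ : IsOpen Ω)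
    {η : ℝ≥0∞} (hη : 0 < η) : ∃ ε : ℝ≥0∞, 0 < ε ∧ ∀ f : Eucl d → Eucl d,
      modular Ω Φ f ≤ ε → luxemburgNorm Ω Φ f < η := by
  obtain ⟨γ, hγ0, hγη⟩ := ENNReal.lt_iff_exists_nnreal_btwn.1 hη
  have hγ0' : 0 < γ := by exact_mod_cast hγ0
  obtain ⟨c, hc1, hc⟩ := hΦ.exists_mul_le γ⁻¹
  refine ⟨(c : ℝ≥0∞)⁻¹, by simp, fun f hf => ?_⟩
  have hle : ∫⁻ x in Ω, Φ x (‖f x‖₊ / γ) ≤ 1 := by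
    calc ∫⁻ x in Ω, Φ x (‖f x‖₊ / γ) ≤ ∫⁻ x in Ω, c * Φ x ‖f x‖₊ := by
          refine setLIntegral_mono' hΩ.measurableSet fun x hx => ?_
          rw [div_eq_inv_mul]
          exact hc x hx _
      _ = c * modular Ω Φ f := lintegral_const_mul' _ _ ENNReal.coe_ne_top
      _ ≤ c * (c : ℝ≥0∞)⁻¹ := by gcongr
      _ ≤ 1 := ENNReal.mul_inv_le_one _
  exact (iInf_le_of_le γ (iInf_le_of_le hγ0' (iInf_le _ hle))).trans_lt hγη

theorem IsTestFunction.isWeakGradient {v : Eucl d → ℝ} (hv : IsTestFunction Ω v) :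
    IsWeakGradient Ω v (gradient v) := by
  have hvg := HasGlobalWeakGradient.of_contDiff hv.1 hv.2.1
  refine ⟨hvg.integrable.locallyIntegrable.locallyIntegrableOn _,
    hvg.integrable_grad.locallyIntegrable.locallyIntegrableOn _, fun ζ hζ => ?_⟩
  have hzero : ∀ {f : Eucl d → ℝ}, IsTestFunction Ω f → ∀ x ∉ Ω, f x = 0 := fun hf x hx =>
    image_eq_zero_of_notMem_tsupport fun h => hx (hf.2.2 h)
  rw [setIntegral_eq_integral_of_forall_compl_eq_zero fun x hx => by simp [hzero hv x hx],
    setIntegral_eq_integral_of_forall_compl_eq_zero fun x hx => by simp [hzero hζ x hx]]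
  have i1 : Integrable fun x => v x • gradient ζ x :=
    (hv.1.continuous.smul (continuous_gradient_of_contDiff hζ.1)).integrable_of_hasCompactSupport
      hv.2.1.smul_right
  have i2 : Integrable fun x => ζ x • gradient v x :=
    (hζ.1.continuous.smul (continuous_gradient_of_contDiff hv.1)).integrable_of_hasCompactSupport
      hζ.2.1.smul_right
  refine ext_inner_left ℝ fun z => ?_
  rw [inner_neg_right, ← integral_inner i1, ← integral_inner i2]
  have h := hvg.integral_eq ζ hζ.1 hζ.2.1 z
  simp_rw [← inner_gradient_eq_fderiv (hζ.1.differentiable (by simp) _)] at h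
  simpa only [real_inner_smul_right, real_inner_comm] using h

theorem IsTestFunction.memW1PhiZero (hΦ : IsAdmissible Ω Φ) (hΩ : IsOpen Ω)
    (hΩfin : volume Ω < ∞) {v : Eucl d → ℝ} (hv : IsTestFunction Ω v) :
    MemW1PhiZero Ω Φ v (gradient v) := by
  have hvg := HasGlobalWeakGradient.of_contDiff hv.1 hv.2.1
  refine ⟨⟨⟨hv.isWeakGradient, hvg.integrable.integrableOn, hvg.integrable_grad.integrableOn⟩,
    fun _ => v, fun _ => hv, ?_, ?_⟩, hvg.integrable_grad.1.restrict, ?_⟩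
  · simp
  · simp
  · obtain ⟨L, hL⟩ := exists_norm_gradient_le hv.1 hv.2.1
    refine luxemburgNorm_lt_top_of_modular_lt_top hΦ hΩ ?_
    refine lt_of_le_of_lt ?_ (hΦ.modular_const_lt_top hΩ hΩfin L)
    exact setLIntegral_mono' hΩ.measurableSet fun x hx => hΦ.monotone hx (hL x)

theorem IsAdmissible.testFunctionsDense (hΦ : IsAdmissible Ω Φ) (hΩ : IsOpen Ω)
    (hΩL : HasLipschitzBoundary Ω) (hΩfin : volume Ω < ∞) : TestFunctionsDense Ω Φ := by
  refine ⟨fun v hv => hv.memW1PhiZero hΦ hΩ hΩfin, fun u G hu η hη => ?_⟩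
  obtain ⟨ε, hε, h⟩ := exists_modular_le_imp_luxemburgNorm_lt hΦ hΩ hη
  obtain ⟨v, hv, -, -, hm⟩ := Approximable.of_memW11Zero hΦ hΩ hΩL hΩfin hu.1
    (modular_lt_top_of_luxemburgNorm_lt_top hΦ hΩ hu.2.2) ε hε
  refine ⟨v, hv, h _ (hm.trans_eq' ?_)⟩
  simp only [modular, ← nnnorm_neg (G _ - _), neg_sub]

end DoublePhase

end

theorem mainTheorem5 {d : ℕ} (hd : 1 ≤ d) (Ω : Set (DoublePhase.Eucl d)) (hΩ : IsOpen Ω)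
    (hΩL : DoublePhase.HasLipschitzBoundary Ω) (hΩfin : volume Ω < ∞)
    (φ ψ : ℝ≥0 → ℝ≥0∞) (hφ : DoublePhase.IsOrlicz φ) (hψ : DoublePhase.IsOrlicz ψ)
    (a : DoublePhase.Eucl d → ℝ) (ha_meas : AEMeasurable a (volume.restrict Ω))
    (ha_nonneg : ∀ x ∈ Ω, 0 ≤ a x) (ha_bdd : ∃ A : ℝ, ∀ x ∈ Ω, a x ≤ A)
    (hΔ : DoublePhase.DeltaTwo Ω (DoublePhase.doublePhase φ ψ a))
    (ω : ℝ → ℝ) (hω : DoublePhase.IsModulusOfContinuityOn Ω a ω) (k₀ : ℝ≥0)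
    (hωφψ : ∀ ε : ℝ, 0 < ε → ε ≤ 1 / 4 → ∀ t : ℝ≥0, 1 ≤ t → (t : ℝ) ≤ ε ^ (-(d : ℤ)) →
      ENNReal.ofReal (ω ε) * ψ t ≤ k₀ * φ t) :
    DoublePhase.IsRegular Ω (DoublePhase.doublePhase φ ψ a) ∧
      DoublePhase.TestFunctionsDense Ω (DoublePhase.doublePhase φ ψ a) := by
  have hΦ := DoublePhase.isAdmissible_doublePhase hφ hψ ha_meas ha_nonneg ha_bdd hΔ hω hωφψ
  exact ⟨hΦ.isRegular hΩ hΩL hΩfin, hΦ.testFunctionsDense hΩ hΩL hΩfin⟩
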